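/- **Setting.** All qubit groups are subgroups of the $n$-qubit Pauli group $\mathrm{Pauli}_n$ (tensor products of $I,X,Y,Z$ with phases $\pm1,\pm i$). A subsystem code on $n$ qubits is given by a gauge group $\mathcal G\subseteq \mathrm{Pauli}_n$ and a stabilizer group $\mathcal S\subseteq \mathcal G$ with $-I\notin\mathcal S$, such that $\mathcal S$ is, up to phases, the center of $\mathcal G$: every element of $\mathcal S$ commutes with $\mathcal G$, and every element of $\mathcal G$ that commutes with $\mathcal G$ is a phase times an element of $\mathcal S$. Either $iI\in\mathcal G$, or $\mathcal G=\mathcal S$ (a stabilizer code). Let $\mathcal H_{\mathrm{sub}}=\{\psi: s\psi=\psi\ \forall s\in\mathcal S\}$. The group $\mathcal L_{\mathrm{bare}}$ of bare logical operators consists of the Pauli operators commuting with $\mathcal G$, and the group $\mathcal L_{\mathrm{dressed}}$ of dressed logical operators consists of the Pauli operators commuting with $\mathcal S$. A bare logical operator is nontrivial if its action on $\mathcal H_{\mathrm{sub}}$ is not a scalar. Two bare logical operators $\ell,\ell'$ are equivalent if $\ell^{-1}\ell'\in\mathcal S$ (for Hermitian $\ell$, this is $\ell\ell'\in\mathcal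 S$). Let $\Xi:(\mathbb C^2)^{\otimes g}\otimes(\mathbb C^2)^{\otimes k}\to(\mathbb C^2)^{\otimes n}$ be an encoding isometry for $g$ gauge qubits and $k$ bare logical qubits: an isometry with range $\mathcal H_{\mathrm{sub}}$ under which every element of $\mathcal G$ acts as $V\otimes I$ and every element of $\mathcal L_{\mathrm{bare}}$ acts as $I\otimes W$. The Choi state is $|\Phi\rangle=(\Xi\otimes I\otimes I)|\mathrm{EPR}\rangle^{\otimes (g+k)}$ on $A R_{\mathrm{gauge}}R_{\mathrm{bare}}$, where $A$ is the $n$-qubit system and $R_{\mathrm{gauge}}$, $R_{\mathrm{bare}}$ are the references of the gauge and of the bare logical qubits. Let $M_1,\dots,M_m$ be mutually commuting Hermitian Pauli operators on $A$ ($M_j=m_jP_j$, with $P_j$ the measured Pauli operator and $m_j=\pm1$ the observed outcome), whose joint outcome is possible, i.e. $\prod_j(I+M_j)|\Phi\rangle\neq0$. Let $\mathcal M=\langle M_1,\dots,M_m\rangle$, and let $|\Phi'\rangle$ be the normalization of $\prod_j(I+M_j)|\Phi\rangle$, the post-measurement Choi state. **Theorem.** The following three statements are equivalent. 1. $\mathcal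 M$ contains no nontrivial dressed logical operator, namely $\mathcal M\cap\mathcal L_{\mathrm{dressed}}\subseteq\mathcal G$. 2. For every nontrivial bare logical operator $\ell$ there is an equivalent bare logical operator $\ell'$ that commutes with all elements of $\mathcal M$. 3. $I(A,R_{\mathrm{bare}})=2k$ in $|\Phi'\rangle$, where $I(A,R_{\mathrm{bare}})=S_A+S_{R_{\mathrm{bare}}}-S_{AR_{\mathrm{bare}}}$ and $S$ is the von Neumann entropy in bits of the reduced state. -/

import Mathlib

open scoped Kronecker Matrix

noncomputable section

namespace QCode

/-- Labels of the computational basis of `n` qubits. -/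
abbrev Bits (n : ℕ) : Type := Fin n → ZMod 2

/-- Operators on `n` qubits, `(ℂ²)^{⊗ n}`, written in the computational basis. -/
abbrev Op (n : ℕ) : Type := Matrix (Bits n) (Bits n) ℂ

/-- The unitary group of `n` qubits. -/
abbrev UnitaryOp (n : ℕ) : Type := Matrix.unitaryGroup (Bits n) ℂ

/-! ### The Pauli group -/

/-- The sign `(-1)^{z · b}`. -/
def bitSign {n : ℕ} (z b : Bits n) : ℂ := ∏ j, (-1 : ℂ) ^ ((z j).val * (b j).val)

/-- The tensor product of `X` over the qubits `j` with `x j = 1`: it maps `|c⟩` to `|c + x⟩`. -/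
def pauliX {n : ℕ} (x : Bits n) : Op n := Matrix.of fun b c => if b = c + x then 1 else 0

/-- The tensor product of `Z` over the qubits `j` with `z j = 1`: it maps `|b⟩` to
`(-1)^{z · b} |b⟩`. -/
def pauliZ {n : ℕ} (z : Bits n) : Op n := Matrix.diagonal (bitSign z)

theorem bitSign_add {n : ℕ} (z b c : Bits n) :
    bitSign z (b + c) = bitSign z b * bitSign z c := by
  unfold bitSign
  rw [← Finset.prod_mul_distrib]
  refine Finset.prod_congr rfl fun j _ => ?_
  rw [← pow_add, Pi.add_apply]
  generalize z j = p
  generalize b j = q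
  generalize c j = r
  have key : ∀ p q r : ZMod 2,
      (p.val * (q + r).val) % 2 = (p.val * q.val + p.val * r.val) % 2 := by decide
  rw [neg_one_pow_eq_pow_mod_two, key p q r, ← neg_one_pow_eq_pow_mod_two]

theorem bitSign_comm {n : ℕ} (z b : Bits n) : bitSign z b = bitSign b z := by
  simp only [bitSign, mul_comm]

theorem bitSign_eq {n : ℕ} (z b : Bits n) : ∃ a : ℕ, bitSign z b = Complex.I ^ a := by
  refine ⟨2 * ∑ j, (z j).val * (b j).val, ?_⟩
  rw [pow_mul, Complex.I_sq, bitSign, Finset.prod_pow_eq_pow_sum]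

theorem pauliX_mul {n : ℕ} (x y : Bits n) : pauliX x * pauliX y = pauliX (x + y) := by
  ext b c
  simp [pauliX, Matrix.mul_apply, add_assoc, add_comm x y]

theorem pauliX_zero {n : ℕ} : pauliX (0 : Bits n) = 1 := by
  ext b c
  simp [pauliX, Matrix.one_apply]

theorem pauliZ_mul {n : ℕ} (y z : Bits n) : pauliZ y * pauliZ z = pauliZ (y + z) := by
  simp only [pauliZ, Matrix.diagonal_mul_diagonal]
  congr 1
  funext b
  rw [bitSign_comm (y + z), bitSign_add, bitSign_comm b, bitSign_comm b]

theorem pauliZ_zero {n : ℕ} : pauliZ (0 : Bits n) = 1 := by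
  rw [pauliZ, show bitSign (0 : Bits n) = 1 from funext fun b => by simp [bitSign]]
  exact Matrix.diagonal_one

theorem pauliZ_mul_pauliX {n : ℕ} (z x : Bits n) :
    pauliZ z * pauliX x = bitSign z x • (pauliX x * pauliZ z) := by
  ext b c
  by_cases h : b = c + x
  · subst h
    simp [pauliX, pauliZ, Matrix.diagonal_mul, Matrix.mul_diagonal, bitSign_add, mul_comm]
  · simp [pauliX, pauliZ, Matrix.diagonal_mul, Matrix.mul_diagonal, h]

theorem bits_add_self {n : ℕ} (x : Bits n) : x + x = 0 := by
  funext j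
  exact CharTwo.add_self_eq_zero (x j)

/-- The Pauli group: the operators `i^a X(x) Z(z)`, that is, the tensor products of
`I, X, Y = i X Z, Z` with a phase in `{1, i, -1, -i}`. -/
def pauliGroup (n : ℕ) : Subgroup (UnitaryOp n) where
  carrier := {U | ∃ (a : ℕ) (x z : Bits n), (U : Op n) = Complex.I ^ a • (pauliX x * pauliZ z)}
  one_mem' := ⟨0, 0, 0, by simp [pauliX_zero, pauliZ_zero]⟩
  mul_mem' := by
    rintro U V ⟨a, x, z, hU⟩ ⟨b, y, w, hV⟩
    obtain ⟨c, hc⟩ := bitSign_eq z y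
    refine ⟨a + b + c, x + y, z + w, ?_⟩
    have h : pauliX x * pauliZ z * (pauliX y * pauliZ w)
        = Complex.I ^ c • (pauliX (x + y) * pauliZ (z + w)) := by
      rw [← hc, ← pauliX_mul, ← pauliZ_mul, Matrix.mul_assoc, ← Matrix.mul_assoc (pauliZ z),
        pauliZ_mul_pauliX]
      simp only [Matrix.smul_mul, Matrix.mul_smul, Matrix.mul_assoc]
    rw [Submonoid.coe_mul, hU, hV, Matrix.smul_mul, Matrix.mul_smul, h, smul_smul, smul_smul,
      pow_add, pow_add, mul_assoc]
  inv_mem' := by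
    rintro U ⟨a, x, z, hU⟩
    obtain ⟨c, hc⟩ := bitSign_eq z x
    refine ⟨3 * a + c, x, z, ?_⟩
    have h : (U : Op n) * (Complex.I ^ (3 * a + c) • (pauliX x * pauliZ z)) = 1 := by
      have h1 : pauliX x * pauliZ z * (pauliX x * pauliZ z) = Complex.I ^ c • (1 : Op n) := by
        rw [← hc, Matrix.mul_assoc, ← Matrix.mul_assoc (pauliZ z), pauliZ_mul_pauliX,
          Matrix.smul_mul, Matrix.mul_smul, Matrix.mul_assoc, pauliZ_mul, bits_add_self,
          pauliZ_zero, Matrix.mul_one, pauliX_mul, bits_add_self, pauliX_zero]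
      have h2 : Complex.I ^ c * Complex.I ^ c = 1 := by
        rw [← hc, ← bitSign_add, bits_add_self]
        simp [bitSign]
      have h3 : Complex.I ^ a * Complex.I ^ (3 * a) = 1 := by
        rw [← pow_add, show a + 3 * a = 4 * a by ring, pow_mul, Complex.I_pow_four, one_pow]
      rw [hU, Matrix.smul_mul, Matrix.mul_smul, h1, smul_smul, smul_smul, pow_add,
        show Complex.I ^ a * (Complex.I ^ (3 * a) * Complex.I ^ c) * Complex.I ^ c
          = (Complex.I ^ a * Complex.I ^ (3 * a)) * (Complex.I ^ c * Complex.I ^ c) by ring,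
        h2, h3, one_mul, one_smul]
    calc ((U⁻¹ : UnitaryOp n) : Op n)
        = ((U⁻¹ : UnitaryOp n) : Op n)
            * ((U : Op n) * (Complex.I ^ (3 * a + c) • (pauliX x * pauliZ z))) := by
          rw [h, Matrix.mul_one]
      _ = _ := by
          rw [← Matrix.mul_assoc, ← Submonoid.coe_mul, inv_mul_cancel, Submonoid.coe_one,
            Matrix.one_mul]

/-- The scalar operator `i I`. -/
def phaseI (n : ℕ) : UnitaryOp n :=
  ⟨Complex.I • 1, by
    rw [Matrix.mem_unitaryGroup_iff]
    simp [smul_smul]⟩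

/-- The centralizer of a subgroup inside the Pauli group. -/
def pauliCentralizer {n : ℕ} (H : Subgroup (UnitaryOp n)) : Subgroup (UnitaryOp n) :=
  pauliGroup n ⊓ Subgroup.centralizer (H : Set (UnitaryOp n))

/-! ### Subsystem codes -/

/-- A (Pauli) subsystem code on `n` qubits, given by its gauge group `gauge` and its stabilizer
group `stab`. Up to phases, `stab` is the center of `gauge`, and `-I ∉ stab`. As to the phases
in `gauge`: either `i I ∈ gauge`, or `gauge = stab`, which is a stabilizer code with its
signed stabilizer group in the role of the gauge group. -/
structure SubsystemCode (n : ℕ) where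
  gauge : Subgroup (UnitaryOp n)
  stab : Subgroup (UnitaryOp n)
  gauge_le_pauli : gauge ≤ pauliGroup n
  stab_le_center : stab ≤ gauge ⊓ Subgroup.centralizer (gauge : Set (UnitaryOp n))
  center_le_stab : gauge ⊓ Subgroup.centralizer (gauge : Set (UnitaryOp n)) ≤
    stab ⊔ Subgroup.zpowers (phaseI n)
  neg_one_notMem : (-1 : UnitaryOp n) ∉ stab
  phases : phaseI n ∈ gauge ∨ gauge = stab

namespace SubsystemCode

variable {n : ℕ} (C : SubsystemCode n)

/-- The stabilized subspace `H_sub = {ψ : s ψ = ψ for all s ∈ stab}`. -/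
def codeSpace : Submodule ℂ (Bits n → ℂ) where
  carrier := {ψ | ∀ s ∈ C.stab, (s : Op n) *ᵥ ψ = ψ}
  zero_mem' := fun s _ => by simp
  add_mem' := fun hv hw s hs => by rw [Matrix.mulVec_add, hv s hs, hw s hs]
  smul_mem' := fun c _ hv s hs => by rw [Matrix.mulVec_smul, hv s hs]

/-- Bare logical operators: the Pauli operators that commute with the gauge group. -/
def bareLogical : Subgroup (UnitaryOp n) := pauliCentralizer C.gauge

/-- Dressed logical operators: the Pauli operators that commute with the stabilizer group. -/
def dressedLogical : Subgroup (UnitaryOp n) := pauliCentralizer C.stab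

/-- A bare logical operator acts on `H_sub = H_gauge ⊗ H_bare` as `I ⊗ U_bare`; it is nontrivial
if `U_bare` is not proportional to the identity, i.e. if it does not act on `H_sub` as a scalar. -/
def IsNontrivialBare (l : UnitaryOp n) : Prop :=
  l ∈ C.bareLogical ∧ ¬ ∃ c : ℂ, ∀ ψ ∈ C.codeSpace, (l : Op n) *ᵥ ψ = c • ψ

/-- Equivalence of bare logical operators: they differ by a stabilizer. For Hermitian `l` one has
`l⁻¹ = l`; the inverse makes this an equivalence relation for all phases. -/
def BareEquiv (l l' : UnitaryOp n) : Prop := l⁻¹ * l' ∈ C.stab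

/-- An encoding isometry `Ξ` of `g` gauge qubits and `k` bare logical qubits: an isometry from
`(ℂ²)^{⊗ g} ⊗ (ℂ²)^{⊗ k}` onto the stabilized subspace which realizes its factorization
`H_gauge ⊗ H_bare`, so that gauge operators act as `V ⊗ I` and bare logical operators act
as `I ⊗ W`. -/
structure Encoding (g k : ℕ) where
  toMatrix : Matrix (Bits n) (Bits g × Bits k) ℂ
  isometry : toMatrixᴴ * toMatrix = 1
  range_eq : LinearMap.range (Matrix.mulVecLin toMatrix) = C.codeSpace
  gauge_action : ∀ U ∈ C.gauge, ∃ V : Op g,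
    (U : Op n) * toMatrix = toMatrix * (V ⊗ₖ (1 : Op k))
  bare_action : ∀ U ∈ C.bareLogical, ∃ W : Op k,
    (U : Op n) * toMatrix = toMatrix * ((1 : Op g) ⊗ₖ W)

end SubsystemCode

/-! ### The Choi state and its measurement -/

/-- `g + k` EPR pairs, between the input of the encoding and the reference
`R_gauge R_bare`. -/
def eprPairs (g k : ℕ) : (Bits g × Bits k) × (Bits g × Bits k) → ℂ :=
  fun p => if p.1 = p.2 then (((Real.sqrt (2 ^ (g + k)))⁻¹ : ℝ) : ℂ) else 0

/-- The Choi state `(Ξ ⊗ I_gauge ⊗ I_bare) |EPR⟩^{⊗ (g + k)}` on `A R_gauge R_bare`. -/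
def choiState {n g k : ℕ} (Ξ : Matrix (Bits n) (Bits g × Bits k) ℂ) :
    Bits n × (Bits g × Bits k) → ℂ :=
  (Ξ ⊗ₖ (1 : Matrix (Bits g × Bits k) (Bits g × Bits k) ℂ)) *ᵥ eprPairs g k

/-- The unnormalized state `∏ⱼ (I + M_j) |φ⟩`, where the `M_j` act on the system `A`. -/
def measure {n g k m : ℕ} (M : Fin m → UnitaryOp n) (φ : Bits n × (Bits g × Bits k) → ℂ) :
    Bits n × (Bits g × Bits k) → ℂ :=
  ((List.ofFn fun j => (1 : Op n) + (M j : Op n)).prod ⊗ₖ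
    (1 : Matrix (Bits g × Bits k) (Bits g × Bits k) ℂ)) *ᵥ φ

/-- The density matrix `|φ⟩⟨φ| / ⟨φ|φ⟩` of the normalization of a nonzero vector. -/
def pureDensity {α : Type*} [Fintype α] (φ : α → ℂ) : Matrix α α ℂ :=
  (star φ ⬝ᵥ φ)⁻¹ • Matrix.vecMulVec φ (star φ)

/-! ### Entropies -/

/-- The partial trace over the second factor. -/
def traceRight {α β : Type*} [Fintype β] (ρ : Matrix (α × β) (α × β) ℂ) : Matrix α α ℂ :=
  Matrix.of fun a a' => ∑ b, ρ (a, b) (a', b)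

/-- The partial trace over the first factor. -/
def traceLeft {α β : Type*} [Fintype α] (ρ : Matrix (α × β) (α × β) ℂ) : Matrix β β ℂ :=
  Matrix.of fun b b' => ∑ a, ρ (a, b) (a, b')

/-- The partial trace over the middle one of three factors. -/
def traceMiddle {α β γ : Type*} [Fintype β] (ρ : Matrix (α × (β × γ)) (α × (β × γ)) ℂ) :
    Matrix (α × γ) (α × γ) ℂ :=
  Matrix.of fun p q => ∑ b, ρ (p.1, (b, p.2)) (q.1, (b, q.2))

/-- The von Neumann entropy in bits, `-∑ λ log₂ λ` over the eigenvalues `λ` of the density matrix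
`ρ` with multiplicity. -/
def entropy {α : Type*} [Fintype α] [DecidableEq α] (ρ : Matrix α α ℂ) : ℝ :=
  (ρ.charpoly.roots.map fun z => -(z.re * Real.logb 2 z.re)).sum

/-- The mutual information `S_α + S_β - S_{αβ}` of a state on two systems. -/
def mutualInfo {α β : Type*} [Fintype α] [Fintype β] [DecidableEq α] [DecidableEq β]
    (ρ : Matrix (α × β) (α × β) ℂ) : ℝ :=
  entropy (traceRight ρ) + entropy (traceLeft ρ) - entropy ρ

end QCode

end

/-!
The measured group `N = ⟨M₁, …, M_m⟩` enters the argument through its dressed part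
`D = N ⊓ C.dressedLogical`. An element of `N` outside `D` anticommutes with a stabilizer and maps
the code space to its orthogonal complement. The basic tool is the double centralizer theorem
`pauliCentralizer_pauliCentralizer_le`: up to phases, a subgroup of the Pauli group is the
centralizer of its centralizer, because the symplectic form on labels is nondegenerate. Phases are
harmless: since the outcome is possible, an element of `N` that acts on the code space as a scalar
acts as the identity (`isPossible_closure_range`).

By the double centralizer theorem, `D ≤ C.gauge` means that `D` commutes with all bare logical
operators. If every nontrivial bare operator can be moved by a stabilizer into the centralizer of
`N`, then `D` commutes with it, as `D` commutes with stabilizers; trivial bare operators commute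
with `D` anyway. Conversely, if `D ≤ C.gauge`, a bare operator commutes with everything that
centralizes both the stabilizer group and the centralizer of `N`, so it lies in the product of
these two groups (`exists_bareEquiv_commute`).

For the mutual information, let `F = ∏ⱼ (I + M_j) Ξ`, the amplitude matrix of the measured Choi
state up to a factor. The product `∏ⱼ (I + M_j)` is a multiple of the sum of all elements of `N`,
so `F† F` is a multiple of the sum of `Ξ† U Ξ` over `U ∈ D`, and its partial traces are multiples
of the partial traces of the sums over `K_g` and `K_b`, the elements of `D` that commute with the
bare logical operators and with the gauge operators. All other terms are killed by an
anticommuting operator on the factor that is traced out. Each of these group sums is a multiple of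
a projection, and so are the reduced states, whose entropies are then logarithms of group orders
(`entropy_eq_neg_logb`). With `K_0 = K_g ⊓ K_b`, the mutual information is
`2 k - log₂ (|D| |K_b| / (|K_g| |K_0|))`, which equals `2 k` exactly when `D = K_g`
(`mutualInfo_eq_iff`), that is, when `D` commutes with all bare logical operators.
-/

namespace QCode

/-! ### Pauli operators and the symplectic form of their labels -/

theorem bitSign_eq_neg_one_pow {n : ℕ} (z x : Bits n) :
    bitSign z x = (-1 : ℂ) ^ (z ⬝ᵥ x).val := by
  have h : z ⬝ᵥ x = ((∑ j, (z j).val * (x j).val : ℕ) : ZMod 2) := by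
    simp [dotProduct]
  rw [h, ZMod.val_natCast, ← neg_one_pow_eq_pow_mod_two, bitSign, Finset.prod_pow_eq_pow_sum]

theorem bitSign_mul_self {n : ℕ} (z x : Bits n) : bitSign z x * bitSign z x = 1 := by
  rw [← bitSign_add, bits_add_self]
  simp [bitSign]

theorem pauliXZ_mul {n : ℕ} (x z y w : Bits n) :
    pauliX x * pauliZ z * (pauliX y * pauliZ w)
      = bitSign z y • (pauliX (x + y) * pauliZ (z + w)) := by
  rw [← pauliX_mul, ← pauliZ_mul, Matrix.mul_assoc, ← Matrix.mul_assoc (pauliZ z),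
    pauliZ_mul_pauliX]
  simp only [Matrix.smul_mul, Matrix.mul_smul, Matrix.mul_assoc]

theorem conjTranspose_pauliX {n : ℕ} (x : Bits n) : (pauliX x)ᴴ = pauliX x := by
  ext b c
  have h : c = b + x ↔ b = c + x := by
    constructor <;> rintro rfl <;> simp [add_assoc, bits_add_self]
  simp [pauliX, Matrix.conjTranspose_apply, h, apply_ite]

theorem conjTranspose_pauliZ {n : ℕ} (z : Bits n) : (pauliZ z)ᴴ = pauliZ z := by
  rw [pauliZ, Matrix.diagonal_conjTranspose]
  congr 1
  funext b
  simp [bitSign_eq_neg_one_pow]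

/-- The Pauli operator `X(x) Z(z)` with label `(x, z)` and trivial phase. -/
def pauliOp {n : ℕ} (u : Bits n × Bits n) : UnitaryOp n :=
  ⟨pauliX u.1 * pauliZ u.2, by
    rw [Matrix.mem_unitaryGroup_iff, Matrix.star_eq_conjTranspose, Matrix.conjTranspose_mul,
      conjTranspose_pauliX, conjTranspose_pauliZ, Matrix.mul_assoc, ← Matrix.mul_assoc (pauliZ _),
      pauliZ_mul, bits_add_self, pauliZ_zero, Matrix.one_mul, pauliX_mul, bits_add_self,
      pauliX_zero]⟩

/-- The symplectic form `z · y + x · w` of the labels `(x, z)` and `(y, w)`; it vanishes exactly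
when the two Pauli operators commute. -/
def symp (n : ℕ) : LinearMap.BilinForm (ZMod 2) (Bits n × Bits n) :=
  LinearMap.mk₂ (ZMod 2) (fun u v => u.2 ⬝ᵥ v.1 + u.1 ⬝ᵥ v.2)
    (fun u u' v => by simp only [Prod.snd_add, Prod.fst_add, add_dotProduct]; ring)
    (fun c u v => by simp [smul_dotProduct, mul_add])
    (fun u v v' => by simp only [Prod.snd_add, Prod.fst_add, dotProduct_add]; ring)
    (fun c u v => by simp [dotProduct_smul, mul_add])

theorem symp_apply {n : ℕ} (u v : Bits n × Bits n) :
    symp n u v = u.2 ⬝ᵥ v.1 + u.1 ⬝ᵥ v.2 := rfl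

theorem symp_swap {n : ℕ} (u v : Bits n × Bits n) : symp n u v = symp n v u := by
  rw [symp_apply, symp_apply, dotProduct_comm u.2, dotProduct_comm u.1, add_comm]

theorem symp_isRefl (n : ℕ) : (symp n).IsRefl := fun u v h => by rw [symp_swap]; exact h

theorem symp_nondegenerate (n : ℕ) : (symp n).Nondegenerate := by
  refine (LinearMap.IsRefl.nondegenerate_iff_separatingLeft (symp_isRefl n)).2 fun u h => ?_
  ext j
  · simpa [symp_apply] using h (0, Pi.single j 1)
  · simpa [symp_apply] using h (Pi.single j 1, 0)

theorem coe_phaseI_zpow {n : ℕ} (a : ℤ) :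
    ((phaseI n ^ a : UnitaryOp n) : Op n) = Complex.I ^ a • (1 : Op n) := by
  have hnat : ∀ a : ℕ, ((phaseI n ^ a : UnitaryOp n) : Op n) = Complex.I ^ a • (1 : Op n) := by
    intro a
    rw [SubmonoidClass.coe_pow]
    simp [phaseI, smul_pow]
  have h4 : phaseI n ^ 4 = 1 := Subtype.ext (by rw [hnat, Complex.I_pow_four, one_smul]; rfl)
  have ha : a = (a % 4).toNat + 4 * (a / 4) := by omega
  rw [ha, zpow_add, zpow_mul, zpow_add₀ Complex.I_ne_zero, zpow_mul, zpow_natCast, zpow_natCast]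
  have h4' : phaseI n ^ (4 : ℤ) = 1 := by exact_mod_cast h4
  have h4'' : Complex.I ^ (4 : ℤ) = 1 := by exact_mod_cast Complex.I_pow_four
  rw [h4', h4'', one_zpow, one_zpow, mul_one, mul_one, hnat]

theorem commute_phaseI {n : ℕ} (U : UnitaryOp n) : Commute (phaseI n) U :=
  Subtype.ext (by simp [phaseI])

theorem commute_of_mem_zpowers_phaseI {n : ℕ} {c : UnitaryOp n}
    (hc : c ∈ Subgroup.zpowers (phaseI n)) (U : UnitaryOp n) : Commute c U := by
  obtain ⟨a, rfl⟩ := hc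
  exact (commute_phaseI U).zpow_left a

theorem neg_one_mem_zpowers_phaseI (n : ℕ) :
    (-1 : UnitaryOp n) ∈ Subgroup.zpowers (phaseI n) :=
  ⟨2, Subtype.ext (by
    rw [coe_phaseI_zpow]
    norm_cast
    rw [Complex.I_sq, neg_smul, one_smul]
    rfl)⟩

theorem commute_phase_mul_left {n : ℕ} {c : UnitaryOp n}
    (hc : c ∈ Subgroup.zpowers (phaseI n)) (U V : UnitaryOp n) :
    Commute (c * U) V ↔ Commute U V := by
  refine ⟨fun h => ?_, fun h => (commute_of_mem_zpowers_phaseI hc V).mul_left h⟩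
  have := (commute_of_mem_zpowers_phaseI (inv_mem hc) V).mul_left h
  rwa [inv_mul_cancel_left] at this

theorem pauliOp_zero {n : ℕ} : pauliOp (0 : Bits n × Bits n) = 1 :=
  Subtype.ext (by simp [pauliOp, pauliX_zero, pauliZ_zero])

theorem exists_pauliOp_add {n : ℕ} (u v : Bits n × Bits n) :
    ∃ c ∈ Subgroup.zpowers (phaseI n), pauliOp (u + v) = c * (pauliOp u * pauliOp v) := by
  obtain ⟨a, ha⟩ := bitSign_eq u.2 v.1
  refine ⟨phaseI n ^ (a : ℤ), ⟨a, rfl⟩, Subtype.ext ?_⟩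
  rw [Submonoid.coe_mul, coe_phaseI_zpow, zpow_natCast, ← ha, Submonoid.coe_mul]
  simp only [pauliOp]
  rw [pauliXZ_mul, Matrix.smul_mul, Matrix.one_mul, smul_smul, bitSign_mul_self, one_smul]
  rfl

theorem pauliOp_mul_comm {n : ℕ} (u v : Bits n × Bits n) :
    (pauliOp u : Op n) * pauliOp v
      = (-1 : ℂ) ^ (symp n u v).val • ((pauliOp v : Op n) * pauliOp u) := by
  have h : ∀ p q : ZMod 2, (p + q).val % 2 = (p.val + q.val) % 2 := by decide
  rw [symp_apply, neg_one_pow_eq_pow_mod_two, h, ← neg_one_pow_eq_pow_mod_two, pow_add,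
    dotProduct_comm u.1, ← bitSign_eq_neg_one_pow, ← bitSign_eq_neg_one_pow]
  simp only [pauliOp]
  rw [pauliXZ_mul, pauliXZ_mul, smul_smul, mul_assoc, bitSign_mul_self, mul_one, add_comm u.1,
    add_comm u.2]

theorem commute_pauliOp_iff {n : ℕ} (u v : Bits n × Bits n) :
    Commute (pauliOp u) (pauliOp v) ↔ symp n u v = 0 := by
  have hc := pauliOp_mul_comm u v
  constructor
  · intro h
    by_contra h0
    have h1 : symp n u v = 1 := by
      revert h0; generalize symp n u v = t; revert t; decide
    have h2 : (pauliOp u : Op n) * pauliOp v = (pauliOp v : Op n) * pauliOp u :=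
      congrArg Subtype.val h
    have h3 : (pauliOp v : Op n) * pauliOp u = 0 := by
      rw [h2, h1] at hc
      have : (1 : ZMod 2).val = 1 := rfl
      rw [this, pow_one, neg_smul, one_smul] at hc
      ext i j
      exact self_eq_neg.1 (congrFun (congrFun hc i) j)
    have h4 : ((pauliOp v * pauliOp u : UnitaryOp n) : Op n)
        * ((pauliOp v * pauliOp u)⁻¹ : UnitaryOp n) = 1 := by
      rw [← Submonoid.coe_mul, mul_inv_cancel, Submonoid.coe_one]
    rw [Submonoid.coe_mul, h3, Matrix.zero_mul] at h4
    exact zero_ne_one h4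
  · intro h
    rw [h] at hc
    exact Subtype.ext (by simpa using hc)

theorem mem_pauliGroup_iff {n : ℕ} (U : UnitaryOp n) :
    U ∈ pauliGroup n ↔ ∃ c ∈ Subgroup.zpowers (phaseI n), ∃ u, U = c * pauliOp u := by
  constructor
  · rintro ⟨a, x, z, h⟩
    refine ⟨phaseI n ^ (a : ℤ), ⟨a, rfl⟩, (x, z), Subtype.ext ?_⟩
    rw [h, Submonoid.coe_mul, coe_phaseI_zpow, zpow_natCast, Matrix.smul_mul, Matrix.one_mul]
    rfl
  · rintro ⟨c, ⟨a, rfl⟩, u, rfl⟩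
    have hi : phaseI n ∈ pauliGroup n := ⟨1, 0, 0, by simp [phaseI, pauliX_zero, pauliZ_zero]⟩
    have hu : pauliOp u ∈ pauliGroup n := ⟨0, u.1, u.2, by simp [pauliOp]⟩
    exact mul_mem (zpow_mem hi a) hu

theorem zpowers_phaseI_le_pauliGroup (n : ℕ) : Subgroup.zpowers (phaseI n) ≤ pauliGroup n :=
  fun c hc => (mem_pauliGroup_iff c).2 ⟨c, hc, 0, by rw [pauliOp_zero, mul_one]⟩

/-- Two Pauli operators commute or anticommute. -/
theorem commute_or_anticommute {n : ℕ} {U V : UnitaryOp n} (hU : U ∈ pauliGroup n)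
    (hV : V ∈ pauliGroup n) : Commute U V ∨ (U : Op n) * V = -((V : Op n) * U) := by
  obtain ⟨c, hc, u, rfl⟩ := (mem_pauliGroup_iff U).1 hU
  obtain ⟨d, hd, v, rfl⟩ := (mem_pauliGroup_iff V).1 hV
  have h := pauliOp_mul_comm u v
  rcases Nat.even_or_odd (symp n u v).val with he | ho
  · left
    rw [commute_phase_mul_left hc, Commute.symm_iff, commute_phase_mul_left hd, Commute.symm_iff]
    exact Subtype.ext (by simpa [he.neg_one_pow] using h)
  · right
    rw [ho.neg_one_pow, neg_smul, one_smul] at h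
    obtain ⟨a, rfl⟩ := hc
    obtain ⟨b, rfl⟩ := hd
    simp only [Submonoid.coe_mul, coe_phaseI_zpow, Matrix.smul_mul, Matrix.mul_smul,
      Matrix.one_mul]
    rw [h, smul_comm]
    simp

theorem finite_pauliGroup (n : ℕ) : (pauliGroup n : Set (UnitaryOp n)).Finite := by
  have hf : (Subgroup.zpowers (phaseI n) : Set (UnitaryOp n)).Finite := by
    refine Set.Finite.subset (Set.finite_range fun a : Fin 4 => phaseI n ^ (a : ℕ)) ?_
    rintro _ ⟨a, rfl⟩
    refine ⟨⟨(a % 4).toNat, by omega⟩, Subtype.ext ?_⟩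
    have ha : a = (a % 4).toNat + 4 * (a / 4) := by omega
    have h4 : Complex.I ^ (4 : ℤ) = 1 := by exact_mod_cast Complex.I_pow_four
    simp only
    rw [← zpow_natCast, coe_phaseI_zpow, coe_phaseI_zpow]
    conv_rhs => rw [ha, zpow_add₀ Complex.I_ne_zero, zpow_mul, h4, one_zpow, mul_one]
  refine Set.Finite.subset (hf.mul (Set.finite_range (pauliOp (n := n)))) fun U hU => ?_
  obtain ⟨c, hc, u, rfl⟩ := (mem_pauliGroup_iff U).1 hU
  exact Set.mul_mem_mul hc ⟨u, rfl⟩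

theorem mem_pauliCentralizer_iff {n : ℕ} {H : Subgroup (UnitaryOp n)} {U : UnitaryOp n} :
    U ∈ pauliCentralizer H ↔ U ∈ pauliGroup n ∧ ∀ h ∈ H, Commute h U := by
  rw [pauliCentralizer, Subgroup.mem_inf, Subgroup.mem_centralizer_iff]
  rfl

/-- The double centralizer theorem of the Pauli group: up to phases, a subgroup is determined by
its centralizer. In terms of labels, a subspace is its own double orthogonal complement. -/
theorem pauliCentralizer_pauliCentralizer_le {n : ℕ} {H : Subgroup (UnitaryOp n)}
    (hH : H ≤ pauliGroup n) :
    pauliCentralizer (pauliCentralizer H) ≤ H ⊔ Subgroup.zpowers (phaseI n) := by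
  have hz : Subgroup.zpowers (phaseI n) ≤ H ⊔ Subgroup.zpowers (phaseI n) := le_sup_right
  let A : AddSubgroup (Bits n × Bits n) :=
    { carrier := {v | pauliOp v ∈ H ⊔ Subgroup.zpowers (phaseI n)}
      zero_mem' := by
        rw [Set.mem_ofPred_eq, pauliOp_zero]
        exact one_mem _
      add_mem' := fun {u v} hu hv => by
        obtain ⟨c, hc, h⟩ := exists_pauliOp_add u v
        rw [Set.mem_ofPred_eq, h]
        exact mul_mem (hz hc) (mul_mem hu hv)
      neg_mem' := fun {v} hv => by
        have h : -v = v := Prod.ext (neg_eq_of_add_eq_zero_left (bits_add_self v.1))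
          (neg_eq_of_add_eq_zero_left (bits_add_self v.2))
        rwa [Set.mem_ofPred_eq, h] }
  let W : Submodule (ZMod 2) (Bits n × Bits n) := AddSubgroup.toZModSubmodule 2 A
  intro U hU
  obtain ⟨hUp, hUc⟩ := mem_pauliCentralizer_iff.1 hU
  obtain ⟨c, hc, u, rfl⟩ := (mem_pauliGroup_iff U).1 hUp
  refine mul_mem (hz hc) ?_
  have hu : u ∈ (symp n).orthogonal ((symp n).orthogonal W) := by
    intro w hw
    refine (commute_pauliOp_iff w u).1 ?_
    have hwH : pauliOp w ∈ pauliCentralizer H := by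
      refine mem_pauliCentralizer_iff.2
        ⟨(mem_pauliGroup_iff _).2 ⟨1, one_mem _, w, (one_mul _).symm⟩, fun h hh => ?_⟩
      obtain ⟨d, hd, v, rfl⟩ := (mem_pauliGroup_iff h).1 (hH hh)
      rw [commute_phase_mul_left hd, commute_pauliOp_iff]
      refine hw v ?_
      have h1 : d⁻¹ * (d * pauliOp v) ∈ H ⊔ Subgroup.zpowers (phaseI n) :=
        mul_mem (hz (inv_mem hd)) (Subgroup.mem_sup_left hh)
      rwa [inv_mul_cancel_left] at h1
    exact ((commute_phase_mul_left hc _ _).1 (hUc _ hwH).symm).symm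
  rw [LinearMap.BilinForm.orthogonal_orthogonal (symp_nondegenerate n) (symp_isRefl n)] at hu
  exact hu

/-! ### Logical operators and the encoding -/

theorem mem_sup_phase {n : ℕ} {H : Subgroup (UnitaryOp n)} {U : UnitaryOp n}
    (h : U ∈ H ⊔ Subgroup.zpowers (phaseI n)) :
    ∃ V ∈ H, ∃ c ∈ Subgroup.zpowers (phaseI n), U = c * V := by
  have : (Subgroup.zpowers (phaseI n)).Normal :=
    ⟨fun c hc U => by
      rwa [← (commute_of_mem_zpowers_phaseI hc U).eq, mul_inv_cancel_right]⟩
  obtain ⟨V, hV, c, hc, rfl⟩ := Subgroup.mem_sup_of_normal_right.1 h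
  exact ⟨V, hV, c, hc, ((commute_of_mem_zpowers_phaseI hc V).eq).symm⟩

theorem exists_coe_eq_smul_one {n : ℕ} {c : UnitaryOp n}
    (hc : c ∈ Subgroup.zpowers (phaseI n)) : ∃ z : ℂ, (c : Op n) = z • (1 : Op n) := by
  obtain ⟨a, rfl⟩ := hc
  exact ⟨_, coe_phaseI_zpow a⟩

theorem coe_inv_mul_coe {n : ℕ} (U : UnitaryOp n) :
    ((U⁻¹ : UnitaryOp n) : Op n) * (U : Op n) = 1 := by
  rw [← Submonoid.coe_mul, inv_mul_cancel, Submonoid.coe_one]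

theorem conjTranspose_coe {n : ℕ} (U : UnitaryOp n) :
    (U : Op n)ᴴ = ((U⁻¹ : UnitaryOp n) : Op n) := rfl

theorem pauliCentralizer_le {n : ℕ} (H : Subgroup (UnitaryOp n)) :
    pauliCentralizer H ≤ pauliGroup n := inf_le_left

namespace SubsystemCode

variable {n g k : ℕ} {C : SubsystemCode n}

theorem stab_le_gauge (C : SubsystemCode n) : C.stab ≤ C.gauge :=
  C.stab_le_center.trans inf_le_left

theorem stab_le_pauli (C : SubsystemCode n) : C.stab ≤ pauliGroup n :=
  C.stab_le_gauge.trans C.gauge_le_pauli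

theorem stab_commute_gauge (C : SubsystemCode n) {s U : UnitaryOp n} (hs : s ∈ C.stab)
    (hU : U ∈ C.gauge) : Commute U s :=
  Subgroup.mem_centralizer_iff.1 (C.stab_le_center hs).2 U hU

theorem bareLogical_le_dressedLogical (C : SubsystemCode n) :
    C.bareLogical ≤ C.dressedLogical := fun _ hU => by
  obtain ⟨h1, h2⟩ := mem_pauliCentralizer_iff.1 hU
  exact mem_pauliCentralizer_iff.2 ⟨h1, fun s hs => h2 s (C.stab_le_gauge hs)⟩

theorem gauge_le_dressedLogical (C : SubsystemCode n) :
    C.gauge ≤ C.dressedLogical := fun _ hU =>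
  mem_pauliCentralizer_iff.2 ⟨C.gauge_le_pauli hU, fun _ hs => (C.stab_commute_gauge hs hU).symm⟩

theorem stab_le_bareLogical (C : SubsystemCode n) : C.stab ≤ C.bareLogical := fun _ hs =>
  mem_pauliCentralizer_iff.2 ⟨C.stab_le_pauli hs, fun _ hU => C.stab_commute_gauge hs hU⟩

namespace Encoding

variable (Ξ : C.Encoding g k)

theorem mulVec_mem_codeSpace (v : Bits g × Bits k → ℂ) : Ξ.toMatrix *ᵥ v ∈ C.codeSpace := by
  rw [← Ξ.range_eq]
  exact ⟨v, rfl⟩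

theorem toMatrix_ne_zero : Ξ.toMatrix ≠ 0 := fun h => by
  have h1 := Ξ.isometry
  rw [h, Matrix.mul_zero] at h1
  exact zero_ne_one h1

theorem stab_mul {s : UnitaryOp n} (hs : s ∈ C.stab) : (s : Op n) * Ξ.toMatrix = Ξ.toMatrix := by
  refine Matrix.ext_of_mulVec_single fun p => ?_
  rw [← Matrix.mulVec_mulVec]
  exact Ξ.mulVec_mem_codeSpace _ s hs

/-- The compression `Ξ† U Ξ` of an operator to the gauge and bare logical qubits. -/
def compress (U : UnitaryOp n) : Matrix (Bits g × Bits k) (Bits g × Bits k) ℂ :=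
  Ξ.toMatrixᴴ * (U : Op n) * Ξ.toMatrix

theorem compress_eq_of_mul_eq {U : UnitaryOp n} {Y : Matrix (Bits g × Bits k) (Bits g × Bits k) ℂ}
    (h : (U : Op n) * Ξ.toMatrix = Ξ.toMatrix * Y) : Ξ.compress U = Y := by
  rw [compress, Matrix.mul_assoc, h, ← Matrix.mul_assoc, Ξ.isometry, Matrix.one_mul]

/-- A dressed logical operator preserves the code space, so it acts there as its compression. -/
theorem mul_eq_mul_compress {U : UnitaryOp n} (hU : U ∈ C.dressedLogical) :
    (U : Op n) * Ξ.toMatrix = Ξ.toMatrix * Ξ.compress U := by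
  refine Matrix.ext_of_mulVec_single fun p => ?_
  rw [compress]
  simp only [← Matrix.mulVec_mulVec]
  set v := Ξ.toMatrix *ᵥ Pi.single p 1 with hv
  have hmem : (U : Op n) *ᵥ v ∈ C.codeSpace := fun s hs => by
    have hc : (s : Op n) * U = U * s :=
      congrArg Subtype.val ((mem_pauliCentralizer_iff.1 hU).2 s hs)
    rw [Matrix.mulVec_mulVec, hc, ← Matrix.mulVec_mulVec, Ξ.mulVec_mem_codeSpace _ s hs]
  rw [← Ξ.range_eq] at hmem
  obtain ⟨w, hw⟩ := hmem
  rw [← hw, Matrix.mulVecLin_apply, Matrix.mulVec_mulVec w, Ξ.isometry, Matrix.one_mulVec]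

theorem compress_mul (U : UnitaryOp n) {V : UnitaryOp n} (hV : V ∈ C.dressedLogical) :
    Ξ.compress (U * V) = Ξ.compress U * Ξ.compress V := by
  rw [compress, Submonoid.coe_mul, Matrix.mul_assoc, Matrix.mul_assoc, Ξ.mul_eq_mul_compress hV,
    ← Matrix.mul_assoc, ← Matrix.mul_assoc, ← compress]

/-- A Pauli operator that anticommutes with a stabilizer maps the code space to its orthogonal
complement. -/
theorem compress_eq_zero {U : UnitaryOp n} (hU : U ∈ pauliGroup n) (hd : U ∉ C.dressedLogical) :
    Ξ.compress U = 0 := by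
  rw [dressedLogical, mem_pauliCentralizer_iff] at hd
  push Not at hd
  obtain ⟨s, hs, hsU⟩ := hd hU
  have h := (commute_or_anticommute (C.stab_le_pauli hs) hU).resolve_left hsU
  have h1 : Ξ.toMatrixᴴ * (s : Op n) = Ξ.toMatrixᴴ := by
    have := congrArg Matrix.conjTranspose (Ξ.stab_mul (inv_mem hs))
    rwa [Matrix.conjTranspose_mul, conjTranspose_coe, inv_inv] at this
  have h2 : Ξ.compress U = -Ξ.compress U := by
    conv_lhs => rw [compress, ← h1, Matrix.mul_assoc _ (s : Op n), h]
    rw [Matrix.mul_neg, Matrix.neg_mul, Matrix.mul_assoc, Matrix.mul_assoc, Ξ.stab_mul hs,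
      ← Matrix.mul_assoc, ← compress]
  ext p q
  exact self_eq_neg.1 (congrFun (congrFun h2 p) q)

theorem exists_compress_eq_kronecker_one {U : UnitaryOp n}
    (hU : U ∈ C.gauge ⊔ Subgroup.zpowers (phaseI n)) :
    ∃ V : Op g, Ξ.compress U = V ⊗ₖ (1 : Op k) := by
  obtain ⟨V, hV, c, hc, rfl⟩ := mem_sup_phase hU
  obtain ⟨z, hz⟩ := exists_coe_eq_smul_one hc
  obtain ⟨X, hX⟩ := Ξ.gauge_action V hV
  refine ⟨z • X, Ξ.compress_eq_of_mul_eq ?_⟩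
  rw [Submonoid.coe_mul, hz, Matrix.smul_mul, Matrix.one_mul, Matrix.smul_mul, hX,
    Matrix.smul_kronecker, Matrix.mul_smul]

theorem exists_compress_eq_one_kronecker {U : UnitaryOp n} (hU : U ∈ C.bareLogical) :
    ∃ W : Op k, Ξ.compress U = (1 : Op g) ⊗ₖ W := by
  obtain ⟨W, hW⟩ := Ξ.bare_action U hU
  exact ⟨W, Ξ.compress_eq_of_mul_eq hW⟩

theorem exists_mul_eq_smul {U : UnitaryOp n} (hU : U ∈ C.stab ⊔ Subgroup.zpowers (phaseI n)) :
    ∃ z : ℂ, (U : Op n) * Ξ.toMatrix = z • Ξ.toMatrix := by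
  obtain ⟨s, hs, c, hc, rfl⟩ := mem_sup_phase hU
  obtain ⟨z, hz⟩ := exists_coe_eq_smul_one hc
  exact ⟨z, by rw [Submonoid.coe_mul, hz, Matrix.smul_mul, Matrix.one_mul, Matrix.smul_mul,
    Ξ.stab_mul hs]⟩

/-- A group of measured operators is possible on the code if its elements act on the code space
as scalars only when they act as the identity. -/
def IsPossible (N : Subgroup (UnitaryOp n)) : Prop :=
  ∀ U ∈ N, ∀ z : ℂ, (U : Op n) * Ξ.toMatrix = z • Ξ.toMatrix → z = 1

variable {Ξ} {N : Subgroup (UnitaryOp n)}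

/-- The signs: when the gauge group does not contain all phases it is the stabilizer group, and
then the possibility of the outcome fixes the phase. -/
theorem IsPossible.mem_gauge (hN : Ξ.IsPossible N) {U : UnitaryOp n} (hU : U ∈ N)
    (h : U ∈ C.gauge ⊔ Subgroup.zpowers (phaseI n)) : U ∈ C.gauge := by
  rcases C.phases with hp | hp
  · rwa [sup_eq_left.2 ((Subgroup.zpowers_le).2 hp)] at h
  · rw [hp] at h ⊢
    obtain ⟨s, hs, c, hc, rfl⟩ := mem_sup_phase h
    obtain ⟨z, hz⟩ := exists_coe_eq_smul_one hc
    have h1 : z = 1 := hN _ hU z (by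
      rw [Submonoid.coe_mul, hz, Matrix.smul_mul, Matrix.one_mul, Matrix.smul_mul, Ξ.stab_mul hs])
    have h2 : c = 1 := Subtype.ext (by rw [hz, h1, one_smul]; rfl)
    rwa [h2, one_mul]

/-- The measured operators that commute with all gauge and all bare logical operators act
trivially on the code space. -/
theorem IsPossible.compress_eq_one (hN : Ξ.IsPossible N) {U : UnitaryOp n} (hU : U ∈ N)
    (hb : U ∈ C.bareLogical) (hg : U ∈ pauliCentralizer C.bareLogical) : Ξ.compress U = 1 := by
  obtain ⟨V, hV, c, hc, rfl⟩ := mem_sup_phase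
    (pauliCentralizer_pauliCentralizer_le C.gauge_le_pauli hg)
  have hVc : V ∈ C.stab ⊔ Subgroup.zpowers (phaseI n) := by
    refine C.center_le_stab ⟨hV, Subgroup.mem_centralizer_iff.2 fun G hG => ?_⟩
    exact ((commute_phase_mul_left hc V G).1
      ((mem_pauliCentralizer_iff.1 hb).2 G hG).symm).symm
  obtain ⟨z, hz⟩ := Ξ.exists_mul_eq_smul (mul_mem (Subgroup.mem_sup_right hc) hVc)
  rw [hN _ hU z hz, one_smul] at hz
  exact Ξ.compress_eq_of_mul_eq (by rw [hz, Matrix.mul_one])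

/-- By the double centralizer theorem, the gauge group consists, up to phases, of the operators
that commute with the bare logical operators. -/
theorem IsPossible.inf_dressed_le_gauge_iff (hN : Ξ.IsPossible N) :
    N ⊓ C.dressedLogical ≤ C.gauge ↔
      N ⊓ C.dressedLogical ≤ pauliCentralizer C.bareLogical := by
  constructor
  · intro h U hU
    exact mem_pauliCentralizer_iff.2 ⟨C.gauge_le_pauli (h hU), fun l hl =>
      ((mem_pauliCentralizer_iff.1 hl).2 U (h hU)).symm⟩
  · intro h U hU
    exact hN.mem_gauge hU.1 (pauliCentralizer_pauliCentralizer_le C.gauge_le_pauli (h hU))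

/-- A bare logical operator that acts on the code space as a scalar commutes with all dressed
logical operators. -/
theorem commute_of_scalar {l U : UnitaryOp n} (hl : l ∈ C.bareLogical)
    (hU : U ∈ C.dressedLogical) {c : ℂ} (hc : (l : Op n) * Ξ.toMatrix = c • Ξ.toMatrix) :
    Commute l U := by
  refine (commute_or_anticommute (pauliCentralizer_le _ hl)
    (pauliCentralizer_le _ hU)).resolve_right fun h => Ξ.toMatrix_ne_zero ?_
  have h1 : (l : Op n) * ((U : Op n) * Ξ.toMatrix) = c • ((U : Op n) * Ξ.toMatrix) := by
    rw [Ξ.mul_eq_mul_compress hU, ← Matrix.mul_assoc, hc, Matrix.smul_mul]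
  have h2 : (l : Op n) * ((U : Op n) * Ξ.toMatrix) = -(c • ((U : Op n) * Ξ.toMatrix)) := by
    rw [← Matrix.mul_assoc, h, Matrix.neg_mul, Matrix.mul_assoc, hc, Matrix.mul_smul]
  have h3 : (l : Op n) * ((U : Op n) * Ξ.toMatrix) = 0 := by
    rw [h1] at h2 ⊢
    ext p q
    exact self_eq_neg.1 (congrFun (congrFun h2 p) q)
  have h4 := congrArg (fun A => ((U⁻¹ : UnitaryOp n) : Op n) *
    (((l⁻¹ : UnitaryOp n) : Op n) * A)) h3
  simp only [Matrix.mul_zero] at h4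
  rwa [← Matrix.mul_assoc _ (l : Op n), coe_inv_mul_coe, Matrix.one_mul, ← Matrix.mul_assoc,
    coe_inv_mul_coe, Matrix.one_mul] at h4

open scoped Pointwise in
/-- Cleaning: if the measured dressed logical operators are gauge operators, each bare logical
operator lies in the double centralizer of the product of the stabilizer group with the
centralizer of the measured group, so a stabilizer moves it into the latter. -/
theorem exists_bareEquiv_commute (hNp : N ≤ pauliGroup n)
    (h : N ⊓ C.dressedLogical ≤ C.gauge) {l : UnitaryOp n} (hl : l ∈ C.bareLogical) :
    ∃ l' ∈ C.bareLogical, C.BareEquiv l l' ∧ l' ∈ pauliCentralizer N := by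
  have hlp : l ∈ pauliGroup n := pauliCentralizer_le _ hl
  set H := C.stab ⊔ pauliCentralizer N with hH
  have hHp : H ≤ pauliGroup n := sup_le C.stab_le_pauli (pauliCentralizer_le _)
  have hphase : Subgroup.zpowers (phaseI n) ≤ pauliCentralizer N := fun c hc =>
    mem_pauliCentralizer_iff.2 ⟨zpowers_phaseI_le_pauliGroup n hc, fun U _ =>
      (commute_of_mem_zpowers_phaseI hc U).symm⟩
  -- An operator centralizing `H` is, up to a phase, a measured dressed operator, hence a gauge
  -- operator, and so commutes with `l`.
  have hlH : l ∈ pauliCentralizer (pauliCentralizer H) := by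
    refine mem_pauliCentralizer_iff.2 ⟨hlp, fun U hU => ?_⟩
    obtain ⟨hUp, hUc⟩ := mem_pauliCentralizer_iff.1 hU
    have hUN : U ∈ pauliCentralizer (pauliCentralizer N) :=
      mem_pauliCentralizer_iff.2 ⟨hUp, fun V hV => hUc V (Subgroup.mem_sup_right hV)⟩
    obtain ⟨V, hV, c, hc, rfl⟩ := mem_sup_phase (pauliCentralizer_pauliCentralizer_le hNp hUN)
    have hVd : V ∈ C.dressedLogical := mem_pauliCentralizer_iff.2 ⟨hNp hV, fun s hs =>
      ((commute_phase_mul_left hc V s).1 (hUc s (Subgroup.mem_sup_left hs)).symm).symm⟩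
    exact (commute_phase_mul_left hc V l).2 ((mem_pauliCentralizer_iff.1 hl).2 V (h ⟨hV, hVd⟩))
  have hl' := pauliCentralizer_pauliCentralizer_le hHp hlH
  rw [hH, sup_assoc, sup_eq_left.2 hphase] at hl'
  -- Conjugation by a Pauli operator changes at most the sign, which is a phase.
  have hnorm : C.stab ≤ Subgroup.normalizer (pauliCentralizer N : Set (UnitaryOp n)) := by
    have key : ∀ s ∈ C.stab, ∀ V ∈ pauliCentralizer N, s * V * s⁻¹ ∈ pauliCentralizer N := by
      intro s hs V hV
      rcases commute_or_anticommute (C.stab_le_pauli hs) (pauliCentralizer_le _ hV) with h1 | h1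
      · rwa [h1.eq, mul_inv_cancel_right]
      · have h2 : s * V = -1 * (V * s) := Subtype.ext (by
          rw [Submonoid.coe_mul, h1, neg_one_mul]
          rfl)
        rw [h2, mul_assoc, mul_inv_cancel_right]
        exact mul_mem (hphase (neg_one_mem_zpowers_phaseI n)) hV
    intro s hs
    rw [Subgroup.mem_normalizer_iff]
    refine fun V => ⟨key s hs V, fun hV => ?_⟩
    have := key s⁻¹ (inv_mem hs) _ hV
    rwa [inv_inv, mul_assoc, inv_mul_cancel_right, inv_mul_cancel_left] at this
  have hmul : l ∈ (C.stab : Set (UnitaryOp n)) * (pauliCentralizer N : Set (UnitaryOp n)) := by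
    rw [← Subgroup.coe_mul_of_left_le_normalizer_right _ _ hnorm]
    exact hl'
  obtain ⟨s, hs, V, hV, rfl⟩ := hmul
  have hVb : V ∈ C.bareLogical := by
    have := mul_mem (inv_mem (C.stab_le_bareLogical hs)) hl
    rwa [inv_mul_cancel_left] at this
  refine ⟨V, hVb, ?_, hV⟩
  have hsl : Commute s (s * V) :=
    (mem_pauliCentralizer_iff.1 hl).2 s (C.stab_le_gauge hs)
  have h1 : (s * V)⁻¹ * V = s⁻¹ := by
    rw [inv_mul_eq_iff_eq_mul, ← hsl.inv_left.eq, inv_mul_cancel_left]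
  rw [BareEquiv, h1]
  exact inv_mem hs

theorem IsPossible.inf_dressed_le_gauge_iff_cleaning (hN : Ξ.IsPossible N)
    (hNp : N ≤ pauliGroup n) :
    N ⊓ C.dressedLogical ≤ C.gauge ↔
      ∀ l, C.IsNontrivialBare l → ∃ l' ∈ C.bareLogical, C.BareEquiv l l' ∧
        l' ∈ pauliCentralizer N := by
  refine ⟨fun h l hl => exists_bareEquiv_commute hNp h hl.1, fun h => ?_⟩
  refine hN.inf_dressed_le_gauge_iff.2 fun U hU => mem_pauliCentralizer_iff.2
    ⟨hNp hU.1, fun l hl => ?_⟩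
  -- A trivial bare operator needs no cleaning: it commutes with all dressed operators.
  by_cases hnt : C.IsNontrivialBare l
  · obtain ⟨l', -, hequiv, hcomm⟩ := h l hnt
    have h1 : Commute (l⁻¹ * l') U := (mem_pauliCentralizer_iff.1 hU.2).2 _ hequiv
    have h2 : Commute U l' := (mem_pauliCentralizer_iff.1 hcomm).2 U hU.1
    have h3 : l = l' * (l⁻¹ * l')⁻¹ := by group
    rw [h3]
    exact h2.symm.mul_left h1.inv_left
  · have h1 : ∃ c : ℂ, ∀ ψ ∈ C.codeSpace, (l : Op n) *ᵥ ψ = c • ψ := by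
      by_contra h2
      exact hnt ⟨hl, h2⟩
    obtain ⟨c, hc⟩ := h1
    refine commute_of_scalar (Ξ := Ξ) (c := c) hl hU.2 (Matrix.ext_of_mulVec_single fun p => ?_)
    rw [← Matrix.mulVec_mulVec, hc _ (Ξ.mulVec_mem_codeSpace _), Matrix.smul_mulVec]

end Encoding

end SubsystemCode

/-! ### Entropy of multiples of projections -/

/-- A matrix of trace one with `ρ² = c ρ` has all its eigenvalues in `{0, c}`, so each eigenvalue
`z` contributes `-z log₂ c` to the entropy. -/
theorem entropy_eq_neg_logb {α : Type*} [Fintype α] [DecidableEq α] {ρ : Matrix α α ℂ} {c : ℝ}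
    (h2 : ρ * ρ = (c : ℂ) • ρ) (htr : ρ.trace = 1) : entropy ρ = -Real.logb 2 c := by
  have hroot : ∀ z ∈ ρ.charpoly.roots, -(z.re * Real.logb 2 z.re) = -Real.logb 2 c * z.re := by
    intro z hz
    have hz' : z = 0 ∨ z = c := by
      have hev : Module.End.HasEigenvalue (Matrix.toLin' ρ) z := by
        rw [Module.End.hasEigenvalue_iff_isRoot_charpoly, Matrix.charpoly_toLin']
        exact Polynomial.isRoot_of_mem_roots hz
      obtain ⟨v, hv⟩ := hev.exists_hasEigenvector
      have h1 : ρ *ᵥ v = z • v := by simpa using hv.apply_eq_smul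
      have h3 : (z * z) • v = ((c : ℂ) * z) • v := by
        rw [mul_smul, ← h1, ← Matrix.mulVec_smul, ← h1, Matrix.mulVec_mulVec, h2,
          Matrix.smul_mulVec, h1, smul_smul]
      rw [← sub_eq_zero, ← sub_smul, smul_eq_zero, or_iff_left hv.2, ← sub_mul, mul_eq_zero,
        sub_eq_zero] at h3
      exact h3.symm
    rcases hz' with rfl | rfl
    · simp
    · rw [Complex.ofReal_re]
      ring
  have hsum : (ρ.charpoly.roots.map Complex.re).sum = 1 := by
    have h := Matrix.trace_eq_sum_roots_charpoly ρ
    rw [htr] at h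
    have := congrArg Complex.reAddGroupHom h
    rw [map_multiset_sum] at this
    simpa using this.symm
  rw [entropy, Multiset.map_congr rfl hroot, Multiset.sum_map_mul_left, hsum, mul_one]

open scoped ComplexOrder in
/-- The nonzero spectra of `F F†` and `F† F` agree; here, for multiples of projections. -/
theorem mul_conjTranspose_sq {α β : Type*} [Fintype α] [Fintype β] {F : Matrix α β ℂ} {c : ℝ}
    (h : (Fᴴ * F) * (Fᴴ * F) = (c : ℂ) • (Fᴴ * F)) :
    (F * Fᴴ) * (F * Fᴴ) = (c : ℂ) • (F * Fᴴ) := by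
  -- `F F† F = c F`, since the Gram matrix of the difference vanishes.
  have h1 : F * (Fᴴ * F) - (c : ℂ) • F = 0 := by
    have h2 : (F * (Fᴴ * F) - (c : ℂ) • F)ᴴ * (F * (Fᴴ * F) - (c : ℂ) • F)
        = (Fᴴ * F) * (Fᴴ * F) * (Fᴴ * F) - (c : ℂ) • ((Fᴴ * F) * (Fᴴ * F))
          - (c : ℂ) • ((Fᴴ * F) * (Fᴴ * F) - (c : ℂ) • (Fᴴ * F)) := by
      simp only [Matrix.conjTranspose_sub, Matrix.conjTranspose_mul, Matrix.conjTranspose_smul,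
        Matrix.conjTranspose_conjTranspose, Matrix.sub_mul, Matrix.mul_sub, Matrix.smul_mul,
        Matrix.mul_smul, Complex.star_def, Complex.conj_ofReal, Matrix.mul_assoc, smul_sub]
    rw [← Matrix.conjTranspose_mul_self_eq_zero, h2, h, Matrix.smul_mul, h, sub_self, sub_self,
      smul_zero, sub_zero]
  rw [sub_eq_zero] at h1
  rw [← Matrix.mul_assoc, Matrix.mul_assoc F Fᴴ F, h1, Matrix.smul_mul]

/-! ### Partial traces -/

section PartialTrace

variable {α β : Type*}

theorem trace_traceRight [Fintype α] [Fintype β] (ρ : Matrix (α × β) (α × β) ℂ) :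
    (traceRight ρ).trace = ρ.trace := by
  simp [traceRight, Matrix.trace, Fintype.sum_prod_type]

theorem trace_traceLeft [Fintype α] [Fintype β] (ρ : Matrix (α × β) (α × β) ℂ) :
    (traceLeft ρ).trace = ρ.trace := by
  simp [traceLeft, Matrix.trace, Fintype.sum_prod_type_right]

/-- The partial trace over the second factor as a linear map. -/
def traceRightLin (α β : Type*) [Fintype β] :
    Matrix (α × β) (α × β) ℂ →ₗ[ℂ] Matrix α α ℂ where
  toFun := traceRight
  map_add' A B := by ext; simp [traceRight, Finset.sum_add_distrib]
  map_smul' c A := by ext; simp [traceRight, Finset.mul_sum]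

/-- The partial trace over the first factor as a linear map. -/
def traceLeftLin (α β : Type*) [Fintype α] :
    Matrix (α × β) (α × β) ℂ →ₗ[ℂ] Matrix β β ℂ where
  toFun := traceLeft
  map_add' A B := by ext; simp [traceLeft, Finset.sum_add_distrib]
  map_smul' c A := by ext; simp [traceLeft, Finset.mul_sum]

theorem traceRight_kronecker_one [Fintype β] [DecidableEq β] (A : Matrix α α ℂ) :
    traceRight (A ⊗ₖ (1 : Matrix β β ℂ)) = (Fintype.card β : ℂ) • A := by
  ext a a'
  simp [traceRight, Matrix.kroneckerMap_apply]

theorem traceLeft_one_kronecker [Fintype α] [DecidableEq α] (B : Matrix β β ℂ) :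
    traceLeft ((1 : Matrix α α ℂ) ⊗ₖ B) = (Fintype.card α : ℂ) • B := by
  ext b b'
  simp [traceLeft, Matrix.kroneckerMap_apply]

theorem traceRight_one_kronecker_mul_comm [Fintype α] [Fintype β] [DecidableEq α]
    (B : Matrix β β ℂ) (Q : Matrix (α × β) (α × β) ℂ) :
    traceRight (((1 : Matrix α α ℂ) ⊗ₖ B) * Q) = traceRight (Q * ((1 : Matrix α α ℂ) ⊗ₖ B)) := by
  ext a a'
  simp only [traceRight, Matrix.of_apply, Matrix.mul_apply, Fintype.sum_prod_type,
    Matrix.kroneckerMap_apply, Matrix.one_apply, ite_mul, one_mul, zero_mul, mul_ite, mul_zero]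
  simp only [Finset.sum_comm (γ := α) (α := β), Finset.sum_ite_eq, Finset.sum_ite_eq',
    Finset.mem_univ, if_true]
  rw [Finset.sum_comm]
  simp only [mul_comm]

theorem traceLeft_kronecker_one_mul_comm [Fintype α] [Fintype β] [DecidableEq β]
    (A : Matrix α α ℂ) (Q : Matrix (α × β) (α × β) ℂ) :
    traceLeft ((A ⊗ₖ (1 : Matrix β β ℂ)) * Q) = traceLeft (Q * (A ⊗ₖ (1 : Matrix β β ℂ))) := by
  ext b b'
  simp only [traceLeft, Matrix.of_apply, Matrix.mul_apply, Fintype.sum_prod_type,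
    Matrix.kroneckerMap_apply, Matrix.one_apply, ite_mul, mul_one, zero_mul, mul_ite, mul_zero,
    Finset.sum_ite_eq, Finset.sum_ite_eq', Finset.mem_univ, if_true]
  rw [Finset.sum_comm]
  simp only [mul_comm]

/-- A matrix that anticommutes with an invertible matrix on the traced-out factor has vanishing
partial trace. -/
theorem traceRight_eq_zero_of_anticommute [Fintype α] [Fintype β] [DecidableEq α] [DecidableEq β]
    {B B' : Matrix β β ℂ} {Q : Matrix (α × β) (α × β) ℂ}
    (h1 : ((1 : Matrix α α ℂ) ⊗ₖ B') * (1 ⊗ₖ B) = 1)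
    (h : Q * ((1 : Matrix α α ℂ) ⊗ₖ B) = -(((1 : Matrix α α ℂ) ⊗ₖ B) * Q)) :
    traceRight Q = 0 := by
  have h2 : ((1 : Matrix α α ℂ) ⊗ₖ B) * (1 ⊗ₖ B') = 1 := mul_eq_one_comm.1 h1
  have h3 : traceRight Q = -traceRight Q := by
    conv_lhs => rw [← Matrix.one_mul Q, ← h1, Matrix.mul_assoc, ← neg_neg ((1 ⊗ₖ B) * Q), ← h,
      Matrix.mul_neg, ← neg_one_smul ℂ, show ∀ A : Matrix (α × β) (α × β) ℂ,
        traceRight ((-1 : ℂ) • A) = (-1 : ℂ) • traceRight A from (traceRightLin α β).map_smul _,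
      traceRight_one_kronecker_mul_comm, Matrix.mul_assoc, h2, Matrix.mul_one, neg_one_smul]
  ext a a'
  exact self_eq_neg.1 (congrFun (congrFun h3 a) a')

theorem traceLeft_eq_zero_of_anticommute [Fintype α] [Fintype β] [DecidableEq α] [DecidableEq β]
    {A A' : Matrix α α ℂ} {Q : Matrix (α × β) (α × β) ℂ}
    (h1 : (A' ⊗ₖ (1 : Matrix β β ℂ)) * (A ⊗ₖ 1) = 1)
    (h : Q * (A ⊗ₖ (1 : Matrix β β ℂ)) = -((A ⊗ₖ (1 : Matrix β β ℂ)) * Q)) :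
    traceLeft Q = 0 := by
  have h2 : (A ⊗ₖ (1 : Matrix β β ℂ)) * (A' ⊗ₖ 1) = 1 := mul_eq_one_comm.1 h1
  have h3 : traceLeft Q = -traceLeft Q := by
    conv_lhs => rw [← Matrix.one_mul Q, ← h1, Matrix.mul_assoc, ← neg_neg ((A ⊗ₖ 1) * Q), ← h,
      Matrix.mul_neg, ← neg_one_smul ℂ, show ∀ A : Matrix (α × β) (α × β) ℂ,
        traceLeft ((-1 : ℂ) • A) = (-1 : ℂ) • traceLeft A from (traceLeftLin α β).map_smul _,
      traceLeft_kronecker_one_mul_comm, Matrix.mul_assoc, h2, Matrix.mul_one, neg_one_smul]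
  ext a a'
  exact self_eq_neg.1 (congrFun (congrFun h3 a) a')

end PartialTrace

/-! ### Sums over Pauli subgroups -/

open scoped Classical in
/-- The elements of the Pauli group that lie in `K`, as a finite set. -/
noncomputable def elems {n : ℕ} (K : Subgroup (UnitaryOp n)) : Finset (UnitaryOp n) :=
  (finite_pauliGroup n).toFinset.filter (· ∈ K)

theorem mem_elems {n : ℕ} {K : Subgroup (UnitaryOp n)} (hK : K ≤ pauliGroup n) {U : UnitaryOp n} :
    U ∈ elems K ↔ U ∈ K := by
  simpa [elems] using fun h => hK h

theorem card_elems_pos {n : ℕ} (K : Subgroup (UnitaryOp n)) : 0 < (elems K).card :=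
  Finset.card_pos.2 ⟨1, by simp [elems, one_mem]⟩

theorem elems_subset {n : ℕ} {K L : Subgroup (UnitaryOp n)} (h : K ≤ L) : elems K ⊆ elems L := fun U hU => by
  simp only [elems, Finset.mem_filter] at hU ⊢
  exact ⟨hU.1, h hU.2⟩

theorem sum_elems_mul_left {n : ℕ} {A : Type*} [AddCommMonoid A] {K : Subgroup (UnitaryOp n)}
    (hK : K ≤ pauliGroup n) {U : UnitaryOp n} (hU : U ∈ K) (f : UnitaryOp n → A) :
    ∑ V ∈ elems K, f (U * V) = ∑ V ∈ elems K, f V := by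
  refine Finset.sum_nbij' (U * ·) (U⁻¹ * ·) ?_ ?_ ?_ ?_ fun _ _ => rfl
  · exact fun V hV => (mem_elems hK).2 (mul_mem hU ((mem_elems hK).1 hV))
  · exact fun V hV => (mem_elems hK).2 (mul_mem (inv_mem hU) ((mem_elems hK).1 hV))
  · simp
  · simp

/-- The sum of a multiplicative family over a group is a multiple of an idempotent. -/
theorem sum_elems_mul_sum_elems {n : ℕ} {A : Type*} [Semiring A] {K : Subgroup (UnitaryOp n)}
    (hK : K ≤ pauliGroup n) {f : UnitaryOp n → A}
    (hf : ∀ U ∈ K, ∀ V ∈ K, f (U * V) = f U * f V) :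
    (∑ U ∈ elems K, f U) * ∑ U ∈ elems K, f U = (elems K).card • ∑ U ∈ elems K, f U := by
  rw [Finset.sum_mul, ← Finset.sum_const]
  refine Finset.sum_congr rfl fun U hU => ?_
  have hU' := (mem_elems hK).1 hU
  rw [Finset.mul_sum]
  conv_rhs => rw [← sum_elems_mul_left hK hU']
  exact Finset.sum_congr rfl fun V hV => (hf U hU' V ((mem_elems hK).1 hV)).symm

theorem sum_elems_of_le {n : ℕ} {A : Type*} [AddCommMonoid A] {K L : Subgroup (UnitaryOp n)}
    (hK : K ≤ pauliGroup n) (hL : L ≤ K) {f : UnitaryOp n → A}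
    (hf : ∀ U ∈ K, U ∉ L → f U = 0) : ∑ U ∈ elems K, f U = ∑ U ∈ elems L, f U :=
  (Finset.sum_subset (elems_subset hL) fun U hU hUL =>
    hf U ((mem_elems hK).1 hU) fun h => hUL ((mem_elems (hL.trans hK)).2 h)).symm

/-! ### The measured projection -/

theorem mul_prod_one_add {n : ℕ} {L : List (Op n)} (hsq : ∀ A ∈ L, A * A = 1)
    (hcomm : ∀ A ∈ L, ∀ B ∈ L, Commute A B) {A : Op n} (hA : A ∈ L) :
    A * (L.map (1 + ·)).prod = (L.map (1 + ·)).prod := by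
  induction L with
  | nil => simp at hA
  | cons B L ih =>
    rw [List.map_cons, List.prod_cons, ← Matrix.mul_assoc]
    rcases List.mem_cons.1 hA with rfl | hA'
    · rw [Matrix.mul_add, Matrix.mul_one, hsq A hA, add_comm]
    · have h : A * (1 + B) = (1 + B) * A :=
        ((Commute.one_right A).add_right (hcomm A hA B List.mem_cons_self)).eq
      rw [h, Matrix.mul_assoc, ih (fun C hC => hsq C (List.mem_cons_of_mem _ hC))
        (fun C hC D hD => hcomm C (List.mem_cons_of_mem _ hC) D (List.mem_cons_of_mem _ hD)) hA']

theorem mul_prod_one_add_of_mul_eq {n : ℕ} {L : List (Op n)} {S : Op n}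
    (h : ∀ A ∈ L, S * A = S) : S * (L.map (1 + ·)).prod = (2 : ℂ) ^ L.length • S := by
  induction L with
  | nil => simp
  | cons B L ih =>
    rw [List.map_cons, List.prod_cons, ← Matrix.mul_assoc, Matrix.mul_add, Matrix.mul_one,
      h B List.mem_cons_self, ← two_smul ℂ, Matrix.smul_mul,
      ih fun A hA => h A (List.mem_cons_of_mem _ hA), smul_smul, List.length_cons, pow_succ']

/-- The product `∏ⱼ (I + M_j)`. -/
def outcomeOp {n m : ℕ} (M : Fin m → UnitaryOp n) : Op n :=
  (List.ofFn fun j => (1 : Op n) + (M j : Op n)).prod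

theorem outcomeOp_eq {n m : ℕ} (M : Fin m → UnitaryOp n) :
    outcomeOp M = ((List.ofFn fun j => (M j : Op n)).map (1 + ·)).prod := by
  rw [List.map_ofFn]
  rfl

section Outcome

variable {n m : ℕ} {M : Fin m → UnitaryOp n}

theorem closure_range_le_pauliGroup (hM_pauli : ∀ j, M j ∈ pauliGroup n) :
    Subgroup.closure (Set.range M) ≤ pauliGroup n := by
  rw [Subgroup.closure_le]
  rintro _ ⟨j, rfl⟩
  exact hM_pauli j

theorem mul_outcomeOp (hM_herm : ∀ j, (M j : Op n).IsHermitian)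
    (hM_comm : ∀ i j, Commute (M i) (M j)) {U : UnitaryOp n}
    (hU : U ∈ Subgroup.closure (Set.range M)) : (U : Op n) * outcomeOp M = outcomeOp M := by
  induction hU using Subgroup.closure_induction with
  | mem U hU =>
    obtain ⟨j, rfl⟩ := hU
    rw [outcomeOp_eq]
    refine mul_prod_one_add ?_ ?_ (List.mem_ofFn.2 ⟨j, rfl⟩)
    · intro A hA
      obtain ⟨i, rfl⟩ := List.mem_ofFn.1 hA
      have h : (((M i)⁻¹ : UnitaryOp n) : Op n) = M i := (conjTranspose_coe _).symm.trans (hM_herm i)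
      conv_lhs => rw [← h]
      rw [h]
      nth_rw 1 [← h]
      exact coe_inv_mul_coe _
    · intro A hA B hB
      obtain ⟨i, rfl⟩ := List.mem_ofFn.1 hA
      obtain ⟨j, rfl⟩ := List.mem_ofFn.1 hB
      exact congrArg Subtype.val (hM_comm i j)
  | one => rw [Submonoid.coe_one, Matrix.one_mul]
  | mul U V _ _ hU hV => rw [Submonoid.coe_mul, Matrix.mul_assoc, hV, hU]
  | inv U _ hU =>
    conv_lhs => rw [← hU]
    rw [← Matrix.mul_assoc, coe_inv_mul_coe, Matrix.one_mul]

theorem sum_mul_coe {K : Subgroup (UnitaryOp n)} (hK : K ≤ pauliGroup n) {U : UnitaryOp n}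
    (hU : U ∈ K) : (∑ V ∈ elems K, (V : Op n)) * U = ∑ V ∈ elems K, (V : Op n) := by
  rw [Finset.sum_mul]
  refine Finset.sum_nbij' (· * U) (· * U⁻¹) ?_ ?_ ?_ ?_ fun _ _ => rfl
  · exact fun V hV => (mem_elems hK).2 (mul_mem ((mem_elems hK).1 hV) hU)
  · exact fun V hV => (mem_elems hK).2 (mul_mem ((mem_elems hK).1 hV) (inv_mem hU))
  · simp
  · simp

theorem conjTranspose_sum_elems {K : Subgroup (UnitaryOp n)} (hK : K ≤ pauliGroup n) :
    (∑ V ∈ elems K, (V : Op n))ᴴ = ∑ V ∈ elems K, (V : Op n) := by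
  rw [Matrix.conjTranspose_sum]
  refine Finset.sum_nbij' (·⁻¹) (·⁻¹) ?_ ?_ ?_ ?_ fun V _ => conjTranspose_coe V
  · exact fun V hV => (mem_elems hK).2 (inv_mem ((mem_elems hK).1 hV))
  · exact fun V hV => (mem_elems hK).2 (inv_mem ((mem_elems hK).1 hV))
  · simp
  · simp

theorem sum_elems_mul_outcomeOp (hM_pauli : ∀ j, M j ∈ pauliGroup n) :
    (∑ V ∈ elems (Subgroup.closure (Set.range M)), (V : Op n)) * outcomeOp M
      = (2 : ℂ) ^ m • ∑ V ∈ elems (Subgroup.closure (Set.range M)), (V : Op n) := by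
  rw [outcomeOp_eq, mul_prod_one_add_of_mul_eq, List.length_ofFn]
  intro A hA
  obtain ⟨i, rfl⟩ := List.mem_ofFn.1 hA
  exact sum_mul_coe (closure_range_le_pauliGroup hM_pauli) (Subgroup.subset_closure ⟨i, rfl⟩)

/-- Up to a factor, `∏ⱼ (I + M_j)` is the sum of the group generated by the `M_j`: the group sum
absorbs each factor `I + M_j` into a `2`, and the product absorbs each group element. -/
theorem outcomeOp_eq_smul_sum (hM_pauli : ∀ j, M j ∈ pauliGroup n)
    (hM_herm : ∀ j, (M j : Op n).IsHermitian) (hM_comm : ∀ i j, Commute (M i) (M j)) :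
    outcomeOp M = ((2 : ℝ) ^ m / (elems (Subgroup.closure (Set.range M))).card : ℝ) •
      ∑ V ∈ elems (Subgroup.closure (Set.range M)), (V : Op n) := by
  have hK := closure_range_le_pauliGroup hM_pauli
  have h1 := sum_elems_mul_outcomeOp hM_pauli
  rw [Finset.sum_mul, Finset.sum_congr rfl fun V hV =>
    mul_outcomeOp hM_herm hM_comm ((mem_elems hK).1 hV), Finset.sum_const] at h1
  have h0 : ((elems (Subgroup.closure (Set.range M))).card : ℝ) ≠ 0 :=
    Nat.cast_ne_zero.2 (card_elems_pos _).ne'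
  rw [div_eq_inv_mul, mul_smul, eq_inv_smul_iff₀ h0, Nat.cast_smul_eq_nsmul, h1]
  ext a b
  simp

end Outcome

/-! ### Reduced states of the measured Choi state -/

theorem entropy_inv_smul {α : Type*} [Fintype α] [DecidableEq α] {X : Matrix α α ℂ} {c t : ℝ}
    (ht : t ≠ 0) (h2 : X * X = (c : ℂ) • X) (htr : X.trace = t) :
    entropy ((t : ℂ)⁻¹ • X) = -Real.logb 2 (c / t) := by
  have ht' : (t : ℂ) ≠ 0 := Complex.ofReal_ne_zero.2 ht
  refine entropy_eq_neg_logb ?_ ?_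
  · rw [Matrix.smul_mul, Matrix.mul_smul, h2, smul_smul, smul_smul, smul_smul]
    congr 1
    push_cast
    ring
  · rw [Matrix.trace_smul, htr, smul_eq_mul, inv_mul_cancel₀ ht']

/-- For a pure state with amplitude matrix `F` on three systems `α`, `β`, `γ`, the spectra of the
states of `α`, `αγ` and `γ` are those of `F† F` and of its two partial traces. -/
theorem mutualInfo_traceMiddle_pureDensity {α β γ : Type*} [Fintype α] [Fintype β] [Fintype γ]
    [DecidableEq α] [DecidableEq β] [DecidableEq γ] {F : Matrix α (β × γ) ℂ} {r : ℂ} (hr : r ≠ 0)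
    {t a b c : ℝ} (ht : t ≠ 0) (htr : (Fᴴ * F).trace = t)
    (ha : (Fᴴ * F) * (Fᴴ * F) = (a : ℂ) • (Fᴴ * F))
    (hb : traceRight (Fᴴ * F) * traceRight (Fᴴ * F) = (b : ℂ) • traceRight (Fᴴ * F))
    (hc : traceLeft (Fᴴ * F) * traceLeft (Fᴴ * F) = (c : ℂ) • traceLeft (Fᴴ * F)) :
    mutualInfo (traceMiddle (pureDensity fun q : α × (β × γ) => r * F q.1 q.2))
      = -Real.logb 2 (a / t) + -Real.logb 2 (c / t) - -Real.logb 2 (b / t) := by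
  set φ : α × (β × γ) → ℂ := fun q => r * F q.1 q.2 with hφ
  have hnorm : star φ ⬝ᵥ φ = star r * r * t := by
    rw [← htr]
    simp only [hφ, dotProduct, Pi.star_apply, Matrix.trace, Matrix.diag, Matrix.mul_apply,
      Matrix.conjTranspose_apply, Fintype.sum_prod_type, Finset.mul_sum, star_mul]
    rw [Finset.sum_comm]
    refine Finset.sum_congr rfl fun x _ => ?_
    rw [Finset.sum_comm]
    refine Finset.sum_congr rfl fun y _ => Finset.sum_congr rfl fun z _ => by ring
  have hρ : ∀ p q, pureDensity φ p q = (t : ℂ)⁻¹ * (F p.1 p.2 * star (F q.1 q.2)) := by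
    intro p q
    have hr' : star r ≠ 0 := star_ne_zero.2 hr
    have ht' : (t : ℂ) ≠ 0 := Complex.ofReal_ne_zero.2 ht
    rw [pureDensity, hnorm, Matrix.smul_apply, Matrix.vecMulVec_apply]
    simp only [hφ, Pi.star_apply, star_mul, smul_eq_mul]
    field_simp
  let B : Matrix (α × γ) β ℂ := Matrix.of fun p x => F p.1 (x, p.2)
  have hBB : Bᴴ * B = traceRight (Fᴴ * F) := by
    ext x x'
    simp only [B, traceRight, Matrix.mul_apply, Matrix.conjTranspose_apply, Matrix.of_apply,
      Fintype.sum_prod_type]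
    exact Finset.sum_comm
  have h1 : traceMiddle (pureDensity φ) = (t : ℂ)⁻¹ • (B * Bᴴ) := by
    ext p q
    simp only [traceMiddle, hρ, Matrix.of_apply, Matrix.smul_apply, Matrix.mul_apply,
      Matrix.conjTranspose_apply, B, smul_eq_mul, Finset.mul_sum]
  have h2 : traceRight (traceMiddle (pureDensity φ)) = (t : ℂ)⁻¹ • (F * Fᴴ) := by
    ext p q
    simp only [traceMiddle, traceRight, hρ, Matrix.of_apply, Matrix.smul_apply, Matrix.mul_apply,
      Matrix.conjTranspose_apply, smul_eq_mul, Finset.mul_sum, Fintype.sum_prod_type]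
    exact Finset.sum_comm
  have h3 : traceLeft (traceMiddle (pureDensity φ)) = (t : ℂ)⁻¹ • (traceLeft (Fᴴ * F))ᵀ := by
    ext p q
    simp only [traceMiddle, traceLeft, hρ, Matrix.of_apply, Matrix.smul_apply, Matrix.mul_apply,
      Matrix.conjTranspose_apply, Matrix.transpose_apply, smul_eq_mul, Finset.mul_sum]
    rw [Finset.sum_comm]
    simp only [mul_comm (star _)]
  rw [mutualInfo, h2, h3, h1, entropy_inv_smul ht (mul_conjTranspose_sq ha),
    entropy_inv_smul (c := c) ht, entropy_inv_smul (c := b) ht (mul_conjTranspose_sq _)]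
  · rw [Matrix.trace_mul_comm, hBB, trace_traceRight, htr]
  · rw [hBB, hb]
  · rw [← Matrix.transpose_mul, hc, Matrix.transpose_smul]
  · rw [Matrix.trace_transpose, trace_traceLeft, htr]
  · rw [Matrix.trace_mul_comm, htr]

theorem choiState_apply {n g k : ℕ} (Ξ : Matrix (Bits n) (Bits g × Bits k) ℂ) (a : Bits n)
    (p : Bits g × Bits k) :
    choiState Ξ (a, p) = (((Real.sqrt (2 ^ (g + k)))⁻¹ : ℝ) : ℂ) * Ξ a p := by
  rw [choiState, Matrix.mulVec, dotProduct, Fintype.sum_prod_type]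
  simp only [Matrix.kroneckerMap_apply, eprPairs, Matrix.one_apply]
  rw [Finset.sum_eq_single p]
  · rw [Finset.sum_eq_single p]
    · simp [mul_comm]
    · intro q _ hq
      simp [hq.symm]
    · simp
  · intro q _ hq
    refine Finset.sum_eq_zero fun q' _ => ?_
    by_cases h : q = q'
    · subst h
      simp [hq.symm]
    · simp [h]
  · simp

theorem measure_choiState {n g k m : ℕ} (M : Fin m → UnitaryOp n)
    (Ξ : Matrix (Bits n) (Bits g × Bits k) ℂ) :
    measure M (choiState Ξ) = fun q =>
      (((Real.sqrt (2 ^ (g + k)))⁻¹ : ℝ) : ℂ) * (outcomeOp M * Ξ) q.1 q.2 := by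
  funext ⟨a, p⟩
  rw [measure, Matrix.mulVec, dotProduct, Fintype.sum_prod_type]
  simp only [Matrix.kroneckerMap_apply, choiState_apply, Matrix.one_apply]
  rw [Matrix.mul_apply, Finset.mul_sum]
  refine Finset.sum_congr rfl fun b _ => ?_
  rw [Finset.sum_eq_single p]
  · rw [if_pos rfl, outcomeOp]
    ring
  · intro q _ hq
    simp [hq.symm]
  · simp

/-! ### Partial traces of compressed Pauli groups -/

namespace SubsystemCode.Encoding

variable {n g k : ℕ} {C : SubsystemCode n} (Ξ : C.Encoding g k)

theorem compress_one : Ξ.compress 1 = 1 :=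
  Ξ.compress_eq_of_mul_eq (by rw [Submonoid.coe_one, Matrix.one_mul, Matrix.mul_one])

theorem compress_inv_mul_compress {U : UnitaryOp n} (hU : U ∈ C.dressedLogical) :
    Ξ.compress U⁻¹ * Ξ.compress U = 1 := by
  rw [← Ξ.compress_mul _ hU, inv_mul_cancel, Ξ.compress_one]

theorem compress_anticommute {U V : UnitaryOp n} (hU : U ∈ C.dressedLogical)
    (hV : V ∈ C.dressedLogical) (h : ¬ Commute V U) :
    Ξ.compress U * Ξ.compress V = -(Ξ.compress V * Ξ.compress U) := by
  have h1 := (commute_or_anticommute (pauliCentralizer_le _ hU)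
    (pauliCentralizer_le _ hV)).resolve_left fun hc => h hc.symm
  rw [← Ξ.compress_mul _ hU, ← Ξ.compress_mul _ hV, compress, compress, Submonoid.coe_mul, h1,
    Submonoid.coe_mul, Matrix.mul_neg, Matrix.neg_mul]

/-- A dressed operator survives the partial trace over the bare logical qubits only if it commutes
with the bare logical operators. -/
theorem traceRight_compress_eq_zero {U : UnitaryOp n} (hU : U ∈ C.dressedLogical)
    (h : U ∉ pauliCentralizer C.bareLogical) : traceRight (Ξ.compress U) = 0 := by
  rw [mem_pauliCentralizer_iff] at h
  push Not at h
  obtain ⟨l, hl, hlU⟩ := h (pauliCentralizer_le _ hU)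
  have hld := C.bareLogical_le_dressedLogical hl
  obtain ⟨W, hW⟩ := Ξ.exists_compress_eq_one_kronecker hl
  obtain ⟨W', hW'⟩ := Ξ.exists_compress_eq_one_kronecker (inv_mem hl)
  refine traceRight_eq_zero_of_anticommute (B := W) (B' := W') ?_ ?_
  · rw [← hW, ← hW', Ξ.compress_inv_mul_compress hld]
  · rw [← hW, Ξ.compress_anticommute hU hld hlU]

/-- A dressed operator survives the partial trace over the gauge qubits only if it commutes with
the gauge operators, that is, if it is bare. -/
theorem traceLeft_compress_eq_zero {U : UnitaryOp n} (hU : U ∈ C.dressedLogical)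
    (h : U ∉ C.bareLogical) : traceLeft (Ξ.compress U) = 0 := by
  rw [bareLogical, mem_pauliCentralizer_iff] at h
  push Not at h
  obtain ⟨l, hl, hlU⟩ := h (pauliCentralizer_le _ hU)
  have hld := C.gauge_le_dressedLogical hl
  obtain ⟨V, hV⟩ := Ξ.exists_compress_eq_kronecker_one (Subgroup.mem_sup_left hl)
  obtain ⟨V', hV'⟩ := Ξ.exists_compress_eq_kronecker_one (Subgroup.mem_sup_left (inv_mem hl))
  refine traceLeft_eq_zero_of_anticommute (A := V) (A' := V') ?_ ?_
  · rw [← hV, ← hV', Ξ.compress_inv_mul_compress hld]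
  · rw [← hV, Ξ.compress_anticommute hU hld hlU]

/-- The sum of the compressed elements of a Pauli subgroup. -/
noncomputable def groupSum (K : Subgroup (UnitaryOp n)) :
    Matrix (Bits g × Bits k) (Bits g × Bits k) ℂ :=
  ∑ U ∈ elems K, Ξ.compress U

theorem groupSum_inf_dressed {N : Subgroup (UnitaryOp n)} (hN : N ≤ pauliGroup n) :
    Ξ.groupSum N = Ξ.groupSum (N ⊓ C.dressedLogical) :=
  sum_elems_of_le hN inf_le_left fun _ hU hd =>
    Ξ.compress_eq_zero (hN hU) fun h => hd ⟨hU, h⟩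

theorem groupSum_mul_self {K : Subgroup (UnitaryOp n)} (hK : K ≤ C.dressedLogical) :
    Ξ.groupSum K * Ξ.groupSum K = ((elems K).card : ℂ) • Ξ.groupSum K := by
  rw [groupSum, sum_elems_mul_sum_elems (hK.trans (pauliCentralizer_le _)) fun U _ V hV =>
    Ξ.compress_mul U (hK hV), Nat.cast_smul_eq_nsmul]

theorem traceRight_groupSum {K : Subgroup (UnitaryOp n)} (hK : K ≤ C.dressedLogical) :
    traceRight (Ξ.groupSum K) = traceRight (Ξ.groupSum (K ⊓ pauliCentralizer C.bareLogical)) := by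
  change traceRightLin _ _ _ = traceRightLin _ _ _
  rw [groupSum, groupSum, map_sum, map_sum]
  exact sum_elems_of_le (hK.trans (pauliCentralizer_le _)) inf_le_left fun _ hU h =>
    Ξ.traceRight_compress_eq_zero (hK hU) fun h' => h ⟨hU, h'⟩

theorem traceLeft_groupSum {K : Subgroup (UnitaryOp n)} (hK : K ≤ C.dressedLogical) :
    traceLeft (Ξ.groupSum K) = traceLeft (Ξ.groupSum (K ⊓ C.bareLogical)) := by
  change traceLeftLin _ _ _ = traceLeftLin _ _ _
  rw [groupSum, groupSum, map_sum, map_sum]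
  exact sum_elems_of_le (hK.trans (pauliCentralizer_le _)) inf_le_left fun _ hU h =>
    Ξ.traceLeft_compress_eq_zero (hK hU) fun h' => h ⟨hU, h'⟩

theorem card_bits (n : ℕ) : (Fintype.card (Bits n) : ℂ) = 2 ^ n := by
  simp [Bits, ZMod.card]

/-- The summands that survive the partial trace have the form `V ⊗ I`, so the partial trace
inherits its quadratic equation from the group sum. -/
theorem traceRight_groupSum_mul_self {K : Subgroup (UnitaryOp n)} (hK : K ≤ C.dressedLogical) :
    traceRight (Ξ.groupSum K) * traceRight (Ξ.groupSum K)
      = ((2 : ℂ) ^ k * (elems (K ⊓ pauliCentralizer C.bareLogical)).card) •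
        traceRight (Ξ.groupSum K) := by
  rw [Ξ.traceRight_groupSum hK]
  set L := K ⊓ pauliCentralizer C.bareLogical
  have hL : L ≤ C.dressedLogical := inf_le_left.trans hK
  have hY : ∃ Y : Op g, Ξ.groupSum L = Y ⊗ₖ (1 : Op k) := by
    refine Finset.sum_induction _ (fun A => ∃ Y : Op g, A = Y ⊗ₖ (1 : Op k)) ?_ ?_ ?_
    · rintro _ _ ⟨Y, rfl⟩ ⟨Y', rfl⟩
      exact ⟨Y + Y', (Matrix.add_kronecker _ _ _).symm⟩
    · exact ⟨0, (Matrix.zero_kronecker _).symm⟩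
    · intro U hU
      exact Ξ.exists_compress_eq_kronecker_one (pauliCentralizer_pauliCentralizer_le
        C.gauge_le_pauli ((mem_elems (hL.trans (pauliCentralizer_le _))).1 hU).2)
  obtain ⟨Y, hY⟩ := hY
  have h1 := congrArg (traceRightLin (Bits g) (Bits k)) (Ξ.groupSum_mul_self hL)
  rw [map_smul] at h1
  change traceRight _ = _ • traceRight _ at h1
  rw [hY, ← Matrix.mul_kronecker_mul, Matrix.one_mul, traceRight_kronecker_one,
    traceRight_kronecker_one, card_bits] at h1
  rw [hY, traceRight_kronecker_one, card_bits, Matrix.smul_mul, Matrix.mul_smul, h1, smul_smul,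
    smul_smul]

theorem traceLeft_groupSum_mul_self {K : Subgroup (UnitaryOp n)} (hK : K ≤ C.dressedLogical) :
    traceLeft (Ξ.groupSum K) * traceLeft (Ξ.groupSum K)
      = ((2 : ℂ) ^ g * (elems (K ⊓ C.bareLogical)).card) • traceLeft (Ξ.groupSum K) := by
  rw [Ξ.traceLeft_groupSum hK]
  set L := K ⊓ C.bareLogical
  have hL : L ≤ C.dressedLogical := inf_le_left.trans hK
  have hY : ∃ Y : Op k, Ξ.groupSum L = (1 : Op g) ⊗ₖ Y := by
    refine Finset.sum_induction _ (fun A => ∃ Y : Op k, A = (1 : Op g) ⊗ₖ Y) ?_ ?_ ?_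
    · rintro _ _ ⟨Y, rfl⟩ ⟨Y', rfl⟩
      exact ⟨Y + Y', (Matrix.kronecker_add _ _ _).symm⟩
    · exact ⟨0, (Matrix.kronecker_zero _).symm⟩
    · intro U hU
      exact Ξ.exists_compress_eq_one_kronecker
        ((mem_elems (hL.trans (pauliCentralizer_le _))).1 hU).2
  obtain ⟨Y, hY⟩ := hY
  have h1 := congrArg (traceLeftLin (Bits g) (Bits k)) (Ξ.groupSum_mul_self hL)
  rw [map_smul] at h1
  change traceLeft _ = _ • traceLeft _ at h1
  rw [hY, ← Matrix.mul_kronecker_mul, Matrix.one_mul, traceLeft_one_kronecker,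
    traceLeft_one_kronecker, card_bits] at h1
  rw [hY, traceLeft_one_kronecker, card_bits, Matrix.smul_mul, Matrix.mul_smul, h1, smul_smul,
    smul_smul]

variable {Ξ}

/-- Only the operators that act as the identity on the code space contribute to the trace. -/
theorem IsPossible.trace_groupSum {N K : Subgroup (UnitaryOp n)} (hN : Ξ.IsPossible N)
    (hKN : K ≤ N) (hK : K ≤ C.dressedLogical) :
    (Ξ.groupSum K).trace
      = (2 : ℂ) ^ (g + k) *
        (elems (K ⊓ pauliCentralizer C.bareLogical ⊓ C.bareLogical)).card := by
  rw [← trace_traceRight, Ξ.traceRight_groupSum hK, trace_traceRight, ← trace_traceLeft,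
    Ξ.traceLeft_groupSum (inf_le_left.trans hK), trace_traceLeft]
  set L := K ⊓ pauliCentralizer C.bareLogical ⊓ C.bareLogical with hL
  have hLp : L ≤ pauliGroup n := inf_le_right.trans (pauliCentralizer_le _)
  rw [groupSum, Finset.sum_congr rfl fun U hU => hN.compress_eq_one
    (hKN ((mem_elems hLp).1 hU).1.1) ((mem_elems hLp).1 hU).2 ((mem_elems hLp).1 hU).1.2,
    Finset.sum_const, Matrix.trace_smul, Matrix.trace_one, Fintype.card_prod, Nat.cast_mul,
    card_bits, card_bits, nsmul_eq_mul, pow_add, mul_comm]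

end SubsystemCode.Encoding

/-! ### Group orders and mutual information -/

section Outcome

variable {n g k m : ℕ} {C : SubsystemCode n} {Ξ : C.Encoding g k} {M : Fin m → UnitaryOp n}

theorem isPossible_closure_range (hM_pauli : ∀ j, M j ∈ pauliGroup n)
    (hM_herm : ∀ j, (M j : Op n).IsHermitian) (hM_comm : ∀ i j, Commute (M i) (M j))
    (h0 : outcomeOp M * Ξ.toMatrix ≠ 0) :
    Ξ.IsPossible (Subgroup.closure (Set.range M)) := by
  intro U hU z hz
  have h1 : outcomeOp M * (U : Op n) = outcomeOp M := by
    rw [outcomeOp_eq_smul_sum hM_pauli hM_herm hM_comm, Matrix.smul_mul,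
      sum_mul_coe (closure_range_le_pauliGroup hM_pauli) hU]
  have h2 : outcomeOp M * Ξ.toMatrix = z • (outcomeOp M * Ξ.toMatrix) := by
    conv_lhs => rw [← h1, Matrix.mul_assoc, hz, Matrix.mul_smul]
  have h3 : (1 - z) • (outcomeOp M * Ξ.toMatrix) = 0 := by
    rw [sub_smul, one_smul, ← h2, sub_self]
  exact (sub_eq_zero.1 ((smul_eq_zero.1 h3).resolve_right h0)).symm

/-- The Gram matrix of the measured encoding, which is the unnormalized reduced state of the
references up to transposition, is a multiple of the compressed sum of the measured group. -/
theorem exists_gram_eq_smul_groupSum (Ξ : C.Encoding g k) (hM_pauli : ∀ j, M j ∈ pauliGroup n)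
    (hM_herm : ∀ j, (M j : Op n).IsHermitian) (hM_comm : ∀ i j, Commute (M i) (M j)) :
    ∃ κ : ℝ, 0 < κ ∧ (outcomeOp M * Ξ.toMatrix)ᴴ * (outcomeOp M * Ξ.toMatrix)
      = (κ : ℂ) • Ξ.groupSum (Subgroup.closure (Set.range M)) := by
  have hK := closure_range_le_pauliGroup hM_pauli
  have hP := outcomeOp_eq_smul_sum hM_pauli hM_herm hM_comm
  have hS := sum_elems_mul_outcomeOp hM_pauli
  set S := ∑ V ∈ elems (Subgroup.closure (Set.range M)), (V : Op n) with hSdef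
  set c : ℝ := 2 ^ m / (elems (Subgroup.closure (Set.range M))).card
  have hcpos : 0 < c := div_pos (by positivity) (Nat.cast_pos.2 (card_elems_pos _))
  have hherm : (outcomeOp M)ᴴ = outcomeOp M := by
    rw [hP, Matrix.conjTranspose_smul, conjTranspose_sum_elems hK, star_trivial]
  have hsq : outcomeOp M * outcomeOp M = ((2 ^ m * c : ℝ) : ℂ) • S := by
    conv_lhs => rw [hP, Matrix.smul_mul, ← hP, hS]
    ext a b
    simp only [Matrix.smul_apply, Complex.real_smul, smul_eq_mul]
    push_cast
    ring
  refine ⟨2 ^ m * c, by positivity, ?_⟩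
  rw [Matrix.conjTranspose_mul, hherm, Matrix.mul_assoc, ← Matrix.mul_assoc (outcomeOp M), hsq,
    Matrix.smul_mul, Matrix.mul_smul, hSdef, Matrix.sum_mul, Matrix.mul_sum]
  simp only [SubsystemCode.Encoding.groupSum, SubsystemCode.Encoding.compress, Matrix.mul_assoc]

/-- With `d = |D|`, `c = |K_b|`, `b = |K_g|`, `e = |K_0|`, the left side is the mutual information
of the measured state, in the notation of `mutualInfo_eq_iff`. -/
theorem neg_logb_add_eq_iff {κ d b c e : ℝ} (g k : ℕ) (hκ : 0 < κ) (hd : 0 < d) (hb : 0 < b)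
    (hc : 0 < c) (he : 0 < e) :
    -Real.logb 2 (κ * d / (κ * (2 ^ (g + k) * e)))
        + -Real.logb 2 (κ * (2 ^ g * c) / (κ * (2 ^ (g + k) * e)))
        - -Real.logb 2 (κ * (2 ^ k * b) / (κ * (2 ^ (g + k) * e))) = 2 * k ↔ d * c = b * e := by
  have h2 : (2 * k : ℝ) = Real.logb 2 (2 ^ (2 * k)) := by
    rw [Real.logb_pow, Real.logb_self_eq_one (by norm_num)]
    push_cast
    ring
  have hx : κ * d / (κ * (2 ^ (g + k) * e)) ≠ 0 := by positivity
  have hy : κ * (2 ^ g * c) / (κ * (2 ^ (g + k) * e)) ≠ 0 := by positivity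
  have hz : κ * (2 ^ k * b) / (κ * (2 ^ (g + k) * e)) ≠ 0 := by positivity
  rw [h2, sub_neg_eq_add, ← neg_add, neg_add_eq_sub, ← Real.logb_mul hx hy,
    ← Real.logb_div hz (mul_ne_zero hx hy)]
  rw [(Real.logb_injOn_pos (b := 2) (by norm_num)).eq_iff (Set.mem_Ioi.2 (by positivity))
    (Set.mem_Ioi.2 (by positivity))]
  have h3 : κ * (2 ^ k * b) / (κ * (2 ^ (g + k) * e)) /
      (κ * d / (κ * (2 ^ (g + k) * e)) * (κ * (2 ^ g * c) / (κ * (2 ^ (g + k) * e))))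
      = 2 ^ (2 * k) * (b * e / (d * c)) := by
    rw [pow_add, pow_mul', sq]
    field_simp
  rw [h3, mul_eq_left₀ (by positivity), div_eq_one_iff_eq (by positivity), eq_comm]

/-- Comparing the spectra of the three reduced states, maximal mutual information says
`|D| |K_b| = |K_g| |K_0|`, where `D` is the group of measured dressed operators, `K_g` and `K_b`
its subgroups commuting with the bare logical and with the gauge operators, and
`K_0 = K_g ⊓ K_b`. As `K_g ≤ D` and `K_0 ≤ K_b`, this means `D = K_g`. -/
theorem mutualInfo_eq_iff (hM_pauli : ∀ j, M j ∈ pauliGroup n)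
    (hM_herm : ∀ j, (M j : Op n).IsHermitian) (hM_comm : ∀ i j, Commute (M i) (M j))
    (hN : Ξ.IsPossible (Subgroup.closure (Set.range M))) :
    mutualInfo (traceMiddle (pureDensity (measure M (choiState Ξ.toMatrix)))) = 2 * (k : ℝ) ↔
      Subgroup.closure (Set.range M) ⊓ C.dressedLogical ≤ pauliCentralizer C.bareLogical := by
  obtain ⟨κ, hκ, hgram⟩ := exists_gram_eq_smul_groupSum Ξ hM_pauli hM_herm hM_comm
  rw [Ξ.groupSum_inf_dressed (closure_range_le_pauliGroup hM_pauli)] at hgram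
  set D := Subgroup.closure (Set.range M) ⊓ C.dressedLogical with hD
  have hDd : D ≤ C.dressedLogical := inf_le_right
  have hDp : D ≤ pauliGroup n := hDd.trans (pauliCentralizer_le _)
  set Kg := D ⊓ pauliCentralizer C.bareLogical with hKg
  have hr : (((Real.sqrt (2 ^ (g + k)))⁻¹ : ℝ) : ℂ) ≠ 0 :=
    Complex.ofReal_ne_zero.2 (inv_ne_zero (Real.sqrt_ne_zero'.2 (by positivity)))
  have he := card_elems_pos (Kg ⊓ C.bareLogical)
  have hR : traceRight ((κ : ℂ) • Ξ.groupSum D) = (κ : ℂ) • traceRight (Ξ.groupSum D) :=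
    (traceRightLin _ _).map_smul _ _
  have hL : traceLeft ((κ : ℂ) • Ξ.groupSum D) = (κ : ℂ) • traceLeft (Ξ.groupSum D) :=
    (traceLeftLin _ _).map_smul _ _
  rw [measure_choiState, mutualInfo_traceMiddle_pureDensity hr
    (t := κ * (2 ^ (g + k) * (elems (Kg ⊓ C.bareLogical)).card)) (a := κ * (elems D).card)
    (b := κ * (2 ^ k * (elems Kg).card)) (c := κ * (2 ^ g * (elems (D ⊓ C.bareLogical)).card))
    (by positivity), neg_logb_add_eq_iff g k hκ (Nat.cast_pos.2 (card_elems_pos _))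
    (Nat.cast_pos.2 (card_elems_pos _)) (Nat.cast_pos.2 (card_elems_pos _)) (Nat.cast_pos.2 he)]
  · norm_cast
    constructor
    · intro h
      have h1 : (elems D).card ≤ (elems Kg).card := by
        by_contra! hlt
        have h2 : (elems (Kg ⊓ C.bareLogical)).card ≤ (elems (D ⊓ C.bareLogical)).card :=
          Finset.card_le_card (elems_subset (inf_le_inf_right _ inf_le_left))
        exact h.not_gt (Nat.mul_lt_mul_of_lt_of_le hlt h2 (card_elems_pos _))
      have h3 := Finset.eq_of_subset_of_card_le (elems_subset inf_le_left) h1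
      intro U hU
      rw [← mem_elems hDp, ← h3, mem_elems (inf_le_left.trans hDp)] at hU
      exact hU.2
    · intro h
      rw [hKg, inf_eq_left.2 h]
  · rw [hgram, Matrix.trace_smul, hN.trace_groupSum inf_le_left hDd, smul_eq_mul]
    push_cast
    rfl
  · rw [hgram, Matrix.smul_mul, Matrix.mul_smul, Ξ.groupSum_mul_self hDd, smul_smul, smul_smul,
      smul_smul]
    congr 1
    push_cast
    ring
  · rw [hgram, hR, Matrix.smul_mul, Matrix.mul_smul, Ξ.traceRight_groupSum_mul_self hDd, smul_smul,
      smul_smul, smul_smul]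
    congr 1
    push_cast
    ring
  · rw [hgram, hL, Matrix.smul_mul, Matrix.mul_smul, Ξ.traceLeft_groupSum_mul_self hDd, smul_smul,
      smul_smul, smul_smul]
    congr 1
    push_cast
    ring

end Outcome

end QCode

theorem mainTheorem2 {n g k m : ℕ} (C : QCode.SubsystemCode n) (Ξ : C.Encoding g k)
    (M : Fin m → QCode.UnitaryOp n)
    (hM_pauli : ∀ j, M j ∈ QCode.pauliGroup n)
    (hM_herm : ∀ j, (M j : QCode.Op n).IsHermitian)
    (hM_comm : ∀ i j, Commute (M i) (M j))
    (hM_outcome : QCode.measure M (QCode.choiState Ξ.toMatrix) ≠ 0) :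
    List.TFAE [
      Subgroup.closure (Set.range M) ⊓ C.dressedLogical ≤ C.gauge,
      ∀ l, C.IsNontrivialBare l → ∃ l' ∈ C.bareLogical, C.BareEquiv l l' ∧
        l' ∈ QCode.pauliCentralizer (Subgroup.closure (Set.range M)),
      QCode.mutualInfo (QCode.traceMiddle
        (QCode.pureDensity (QCode.measure M (QCode.choiState Ξ.toMatrix)))) = 2 * (k : ℝ)] := by
  have h0 : QCode.outcomeOp M * Ξ.toMatrix ≠ 0 := by
    intro h
    rw [QCode.measure_choiState, h] at hM_outcome
    exact hM_outcome (funext fun q => by simp)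
  have hN := QCode.isPossible_closure_range hM_pauli hM_herm hM_comm h0
  tfae_have 1 ↔ 2 :=
    hN.inf_dressed_le_gauge_iff_cleaning (QCode.closure_range_le_pauliGroup hM_pauli)
  tfae_have 1 ↔ 3 := hN.inf_dressed_le_gauge_iff.trans
    (QCode.mutualInfo_eq_iff hM_pauli hM_herm hM_comm hN).symm
  tfae_finish
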